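/- Let $d\ge 1$, let $M\in\mathbb R^{d\times d}$, and let $S\subseteq\{1,\dots,d\}^2$ be the set of observed positions. For $\theta=(A,B)$ with $A,B\in\mathbb R^{d\times d}$ (identified with a vector in $\mathbb R^{2d^2}$ with its Euclidean structure) let $$R_S(\theta)=\frac1{|S|}\sum_{(i,j)\in S}\big((AB)_{ij}-M_{ij}\big)^2,$$ let $\delta M$ be the residual matrix, $\delta M_{ij}=(AB)_{ij}-M_{ij}$ for $(i,j)\in S$ and $\delta M_{ij}=0$ otherwise, and let $W_{\rm aug}(\theta)=\begin{bmatrix}A\\ B^\top\end{bmatrix}\in\mathbb R^{2d\times d}$. For linearly independent $\alpha_1,\dots,\alpha_k\in\mathbb R^d$, the $\Omega_k$ invariant manifold $\Omega_k(\alpha_1,\dots,\alpha_k)$ is the set of all $(A,B)$ such that every row of $A$ and every column of $B$ lies in $\mathrm{span}\{\alpha_1,\dots,\alpha_k\}$. Consider the bipartite graph on row and column indices in which $i$ and $j$ are adjacent iff $(i,j)\in S$, with its isolated vertices removed. For a connected component $L$ of this graph, the sub-$\Omega_k$ invariant manifold of $L$ is the set of those $(A,B)\in\Omega_k(\alpha_1,\dots,\alpha_k)$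 for which the rows of $A$ and the columns of $B$ with index not in $L$ are zero. Let $0\le k<d$, let $\Omega$ be an $\Omega_k$ or a sub-$\Omega_k$ invariant manifold, and let $\theta_c\in\Omega$. Assume: (1) the largest singular value of the residual $\delta M$ at $\theta_c$ is unique, in the sense that the largest eigenvalue of $\begin{bmatrix}0&-\delta M\\-\delta M^\top&0\end{bmatrix}$ has multiplicity one (in particular $\delta M\ne0$); (2) $\theta_c$ is a second-order stationary point within $\Omega$: $\nabla R_S(\theta_c)=0$ and $\theta^\top\nabla^2R_S(\theta_c)\,\theta\ge0$ for all $\theta\in\Omega$. Let $\lambda_1$ be the largest eigenvalue of $-\nabla^2R_S(\theta_c)$. Then the gradient flow $\dot\theta=-\nabla R_S(\theta)$ has a solution $t\mapsto\varphi(\theta_0,t)$ on $[0,\infty)$ from every initial point $\theta_0$, and for Lebesgue-almost every $\theta_0\in\mathbb R^{2d^2}$ the limit $$\tilde\varphi(t)=\lim_{\alpha\to0^+}\varphi\Big(\theta_c+\alpha\theta_0,\;t+\frac1{\lambda_1}\log\frac1\alpha\Big)$$ exists for every $t\in\mathbb R$, and there are linearly independent $\beta_1,\dots,\beta_{k+1}\in\mathbb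 R^d$ with $\tilde\varphi(t)\in\Omega_{k+1}(\beta_1,\dots,\beta_{k+1})$ for all $t\in\mathbb R$. Moreover the rank goes up by exactly one: $\operatorname{rank}W_{\rm aug}(\tilde\varphi(t))=\operatorname{rank}W_{\rm aug}(\theta_c)+1$ for all $t\in\mathbb R$, and for all sufficiently negative $t$ the two factors of $\tilde\varphi(t)$ have ranks $\operatorname{rank}A_c+1$ and $\operatorname{rank}B_c+1$, where $\theta_c=(A_c,B_c)$. -/

import Mathlib

open Filter Topology MeasureTheory
open scoped Matrix

noncomputable section

/-- The parameters `θ = (A, B)`, vectorized: a point of `ℝ^{2d²}` with its Euclidean structure.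
The left summand indexes the entries of `A`, the right one those of `B`. -/
abbrev Param (d : ℕ) : Type :=
  EuclideanSpace ℝ ((Fin d × Fin d) ⊕ (Fin d × Fin d))

/-- The factor `A` of `θ = (A, B)`. -/
def factorA {d : ℕ} (θ : Param d) : Matrix (Fin d) (Fin d) ℝ :=
  Matrix.of fun i j => θ (Sum.inl (i, j))

/-- The factor `B` of `θ = (A, B)`. -/
def factorB {d : ℕ} (θ : Param d) : Matrix (Fin d) (Fin d) ℝ :=
  Matrix.of fun i j => θ (Sum.inr (i, j))

/-- The augmented matrix: the rows of `A` on top of the (transposed) columns of `B`. -/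
def augMatrix {d : ℕ} (θ : Param d) : Matrix (Fin d ⊕ Fin d) (Fin d) ℝ :=
  Matrix.fromRows (factorA θ) (factorB θ)ᵀ

/-- The empirical risk: the mean squared error of `A * B` over the set `S` of observed positions. -/
def risk {d : ℕ} (S : Finset (Fin d × Fin d)) (M : Matrix (Fin d) (Fin d) ℝ) (θ : Param d) : ℝ :=
  (1 / (S.card : ℝ)) * ∑ p ∈ S, ((factorA θ * factorB θ) p.1 p.2 - M p.1 p.2) ^ 2

/-- The residual matrix: `A * B - M` on the observed positions, `0` elsewhere. -/
def residualMatrix {d : ℕ} (S : Finset (Fin d × Fin d)) (M : Matrix (Fin d) (Fin d) ℝ) (θ : Param d) :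
    Matrix (Fin d) (Fin d) ℝ :=
  Matrix.of fun i j => if (i, j) ∈ S then (factorA θ * factorB θ) i j - M i j else 0

/-- The Hessian of `f` at `x`, as an operator: the derivative of the gradient. -/
def hessian {E : Type*} [NormedAddCommGroup E] [InnerProductSpace ℝ E] [CompleteSpace E]
    (f : E → ℝ) (x : E) : E →L[ℝ] E :=
  fderiv ℝ (gradient f) x

/-- `γ` solves the gradient flow `γ' = -∇f(γ)` on `[0, ∞)` with `γ 0 = x`. -/
def IsGradientFlowFrom {E : Type*} [NormedAddCommGroup E] [InnerProductSpace ℝ E] [CompleteSpace E]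
    (f : E → ℝ) (x : E) (γ : ℝ → E) : Prop :=
  γ 0 = x ∧ ∀ t : ℝ, 0 ≤ t → HasDerivWithinAt γ (-gradient f (γ t)) (Set.Ici 0) t

open Classical in
/-- The gradient flow `φ(x, t)` of `f`: the value at time `t ≥ 0` of the solution that starts
at `x`. (The value is arbitrary if there is no solution on `[0, ∞)`, and at negative times.) -/
def gradFlow {E : Type*} [NormedAddCommGroup E] [InnerProductSpace ℝ E] [CompleteSpace E]
    (f : E → ℝ) (x : E) (t : ℝ) : E :=
  if h : ∃ γ : ℝ → E, IsGradientFlowFrom f x γ then h.choose t else 0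

/-- The invariant manifold generated by `α 0, …, α (k - 1)`: the pairs `(A, B)` such that every row
of `A` and every column of `B` lies in the span of these vectors. -/
def Omega {d k : ℕ} (α : Fin k → Fin d → ℝ) : Set (Param d) :=
  {θ | (∀ i, factorA θ i ∈ Submodule.span ℝ (Set.range α)) ∧
    ∀ j, (factorB θ)ᵀ j ∈ Submodule.span ℝ (Set.range α)}

/-- The bipartite graph of the observed positions: row `i` and column `j` are adjacent if and only
if `(i, j)` is observed. -/
def bipartiteGraph {d : ℕ} (S : Finset (Fin d × Fin d)) : SimpleGraph (Fin d ⊕ Fin d) :=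
  SimpleGraph.fromRel fun u v => ∃ i j, (i, j) ∈ S ∧ u = Sum.inl i ∧ v = Sum.inr j

/-- The associated observation graph: the bipartite graph with its isolated vertices removed. -/
def observationGraph {d : ℕ} (S : Finset (Fin d × Fin d)) :
    SimpleGraph (bipartiteGraph S).support :=
  (bipartiteGraph S).induce (bipartiteGraph S).support

/-- The row indices in a connected component of the observation graph. -/
def compRows {d : ℕ} {S : Finset (Fin d × Fin d)}
    (L : (observationGraph S).ConnectedComponent) : Set (Fin d) :=
  {i | ∃ h : Sum.inl i ∈ (bipartiteGraph S).support,
    (observationGraph S).connectedComponentMk ⟨Sum.inl i, h⟩ = L}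

/-- The column indices in a connected component of the observation graph. -/
def compCols {d : ℕ} {S : Finset (Fin d × Fin d)}
    (L : (observationGraph S).ConnectedComponent) : Set (Fin d) :=
  {j | ∃ h : Sum.inr j ∈ (bipartiteGraph S).support,
    (observationGraph S).connectedComponentMk ⟨Sum.inr j, h⟩ = L}

/-- The sub-manifold of `Omega α` that belongs to the connected component `L`: the rows of `A` and
the columns of `B` whose index is not in `L` vanish. -/
def subOmega {d k : ℕ} {S : Finset (Fin d × Fin d)}
    (L : (observationGraph S).ConnectedComponent) (α : Fin k → Fin d → ℝ) : Set (Param d) :=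
  {θ | θ ∈ Omega α ∧ (∀ i, i ∉ compRows L → factorA θ i = 0) ∧
    ∀ j, j ∉ compCols L → (factorB θ)ᵀ j = 0}

/-- `Ω` is an `Ω_k` invariant manifold or a sub-`Ω_k` invariant manifold. -/
def IsRankInvariantManifold {d : ℕ} (S : Finset (Fin d × Fin d)) (k : ℕ)
    (Ω : Set (Param d)) : Prop :=
  ∃ α : Fin k → Fin d → ℝ, LinearIndependent ℝ α ∧
    (Ω = Omega α ∨ ∃ L : (observationGraph S).ConnectedComponent, Ω = subOmega L α)

/-- The largest singular value of `D` is unique: the largest eigenvalue of the symmetric matrix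
`[[0, -D], [-Dᵀ, 0]]`, whose eigenvalues are `±` the singular values of `D`, has multiplicity one.
(This excludes `D = 0`.) -/
def UniqueTopSingularValue {d : ℕ} (D : Matrix (Fin d) (Fin d) ℝ) : Prop :=
  ∃ σ : ℝ,
    IsGreatest {μ : ℝ | Module.End.HasEigenvalue
      (Matrix.toLin' (Matrix.fromBlocks 0 (-D) (-Dᵀ) 0)) μ} σ ∧
    Module.finrank ℝ (Module.End.eigenspace
      (Matrix.toLin' (Matrix.fromBlocks 0 (-D) (-Dᵀ) 0)) σ) = 1

/-- `x` is a second-order stationary point of `f` within `Ω`: the gradient vanishes at `x`, and the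
quadratic form of the Hessian at `x` is nonnegative on `Ω`. -/
def IsSecondOrderStationaryWithin {E : Type*} [NormedAddCommGroup E] [InnerProductSpace ℝ E]
    [CompleteSpace E] (f : E → ℝ) (Ω : Set E) (x : E) : Prop :=
  gradient f x = 0 ∧ ∀ v ∈ Ω, 0 ≤ inner ℝ v (hessian f x v)

/-- `μ` is the largest (real) eigenvalue of the operator `T`. -/
def IsTopEigenvalue {E : Type*} [NormedAddCommGroup E] [InnerProductSpace ℝ E]
    (T : E →L[ℝ] E) (μ : ℝ) : Prop :=
  IsGreatest {ν : ℝ | Module.End.HasEigenvalue (T : E →ₗ[ℝ] E) ν} μ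

end

/-!
Write `W` for the augmented matrix of `θ` and `N` for the symmetric dilation of its residual. The
gradient flow is `W' = (2 / |S|) N W`, a left multiplication, so a subspace containing the rows of
`W` keeps containing them. At `θc` the quadratic form of `-∇²R` is `(2 / |S|) tr (Vᵀ N V)` minus a
square; hence the top eigenvectors are of the form `u ⊗ w`, with `u` the top eigenvector of `N`, and
every `w` orthogonal to the rows of `W` occurs.

A trajectory released at `θc + a θ₀` is, after the time shift, asymptotic to an orbit that leaves
`θc` at rate `λ₁` along the projection `u ⊗ w` of `θ₀` to the top eigenspace: the Taylor remainder
is quadratic, and the gap below `λ₁` damps the other components of `θ₀`. For almost every `θ₀` the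
vector `w` lies outside the span of the `α i`. The rows of the orbit stay in the span of `w` and the
rows at `θc`, so the rank of `W` grows by at most one. Criticality reads `N W = 0` at `θc`, so `u`
annihilates `W`, and the leading term `u ⊗ w` adds a new direction: the rank grows by at least one.

The same lower bound applies to each factor. For the upper bound, either the residual vanishes on
the block supporting `Ω`, and the orbit leaves `θc` along multiples of `w` only, or second-order
stationarity within `Ω` forces both factors to have full rank `k` at `θc`.
-/

noncomputable section

section Barrier

variable {E : Type*} [NormedAddCommGroup E] [InnerProductSpace ℝ E]

theorem norm_le_of_inner_lt_barrier {x x' : ℝ → E} {m m' : ℝ → ℝ} {a b : ℝ}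
    (hx : ∀ t ∈ Set.Icc a b, HasDerivWithinAt x (x' t) (Set.Ici a) t)
    (hm : ∀ t, HasDerivAt m (m' t) t) (hpos : ∀ t, 0 < m t) (ha : ‖x a‖ ≤ m a)
    (hlt : ∀ t ∈ Set.Icc a b, ‖x t‖ = m t → inner ℝ (x t) (x' t) < m t * m' t) :
    ∀ t ∈ Set.Icc a b, ‖x t‖ ≤ m t := by
  have norm_sq_le : ∀ t ∈ Set.Icc a b, ‖x t‖ ^ 2 ≤ m t ^ 2 := by
    refine image_le_of_deriv_right_lt_deriv_boundary (f' := fun t => 2 * inner ℝ (x t) (x' t))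
      (B' := fun t => 2 * (m t * m' t)) ?_ ?_ ?_ ?_ ?_
    · exact fun t ht => ((hx t ht).norm_sq.continuousWithinAt).mono Set.Icc_subset_Ici_self
    · exact fun t ht => ((hx t ⟨ht.1, ht.2.le⟩).norm_sq).mono (Set.Ici_subset_Ici.2 ht.1)
    · gcongr
    · exact fun t => ((hm t).pow 2).congr_deriv (by simp only [Nat.cast_ofNat]; ring)
    · intro t ht hsq
      have norm_eq : ‖x t‖ = m t := (pow_left_inj₀ (norm_nonneg _) (hpos t).le two_ne_zero).1 hsq
      linarith [hlt t ⟨ht.1, ht.2.le⟩ norm_eq]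
  exact fun t ht => le_of_sq_le_sq (norm_sq_le t ht) (hpos t).le

theorem norm_le_of_perturbed_linear {x q : ℝ → E} {L : E → E} {m m' ρ : ℝ → ℝ} {κ a b : ℝ}
    (hx : ∀ t ∈ Set.Icc a b, HasDerivWithinAt x (L (x t) + q t) (Set.Ici a) t)
    (hL : ∀ t ∈ Set.Icc a b, inner ℝ (x t) (L (x t)) ≤ κ * ‖x t‖ ^ 2)
    (hm : ∀ t, HasDerivAt m (m' t) t) (hpos : ∀ t, 0 < m t) (ha : ‖x a‖ ≤ m a)
    (hq : ∀ t ∈ Set.Icc a b, ‖x t‖ = m t → ‖q t‖ ≤ ρ t)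
    (hlt : ∀ t ∈ Set.Icc a b, κ * m t + ρ t < m' t) :
    ∀ t ∈ Set.Icc a b, ‖x t‖ ≤ m t := by
  refine norm_le_of_inner_lt_barrier hx hm hpos ha fun t ht hxt => ?_
  calc inner ℝ (x t) (L (x t) + q t)
      ≤ κ * ‖x t‖ ^ 2 + ‖x t‖ * ‖q t‖ := by
        rw [inner_add_right]
        exact add_le_add (hL t ht) (real_inner_le_norm _ _)
    _ ≤ κ * m t ^ 2 + m t * ρ t := by
        rw [hxt]
        gcongr
        exacts [(hpos t).le, hq t ht hxt]
    _ = m t * (κ * m t + ρ t) := by ring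
    _ < m t * m' t := mul_lt_mul_of_pos_left (hlt t ht) (hpos t)

end Barrier

section Existence

theorem contDiff_gradient {E : Type*} [NormedAddCommGroup E] [InnerProductSpace ℝ E]
    [CompleteSpace E] {f : E → ℝ} {n : WithTop ℕ∞} (hf : ContDiff ℝ (n + 1) f) :
    ContDiff ℝ n (gradient f) :=
  (InnerProductSpace.toDual ℝ E).symm.contDiff.comp (hf.fderiv_right le_rfl)

theorem contDiff_neg_gradient {E : Type*} [NormedAddCommGroup E] [InnerProductSpace ℝ E]
    [CompleteSpace E] {f : E → ℝ} {n : WithTop ℕ∞} (hf : ContDiff ℝ (n + 1) f) :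
    ContDiff ℝ n fun x => -gradient f x :=
  (contDiff_gradient hf).neg

theorem norm_sub_le_of_damped_gradient_flow {E : Type*} [NormedAddCommGroup E]
    [InnerProductSpace ℝ E] [CompleteSpace E] {f : E → ℝ} (hf : Differentiable ℝ f)
    (hf0 : ∀ x, 0 ≤ f x) {η : E → ℝ} (hη : ∀ x, 0 ≤ η x ∧ η x ≤ 1) {γ : ℝ → E} {T : ℝ}
    (hγ : ∀ t ∈ Set.Icc 0 T,
      HasDerivWithinAt γ (η (γ t) • -gradient f (γ t)) (Set.Icc 0 T) t) :
    ∀ t ∈ Set.Icc 0 T, ‖γ t - γ 0‖ ≤ T + f (γ 0) := by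
  have deriv_energy : ∀ t ∈ Set.Icc 0 T, HasDerivWithinAt (fun s => f (γ s))
      (-(η (γ t) * ‖gradient f (γ t)‖ ^ 2)) (Set.Icc 0 T) t := by
    intro t ht
    refine (((hf (γ t)).hasGradientAt.hasFDerivAt).comp_hasDerivWithinAt t (hγ t ht)).congr_deriv ?_
    rw [InnerProductSpace.toDual_apply_apply, inner_smul_right, inner_neg_right,
      real_inner_self_eq_norm_sq]
    ring
  have deriv_budget : ∀ t ∈ Set.Icc 0 T, HasDerivWithinAt (fun s => s + (f (γ 0) - f (γ s)))
      (1 + η (γ t) * ‖gradient f (γ t)‖ ^ 2) (Set.Icc 0 T) t := fun t ht =>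
    ((hasDerivWithinAt_id t _).add ((deriv_energy t ht).const_sub _)).congr_deriv
      (by rw [neg_neg])
  -- The speed `η ‖∇f‖` is at most `1 + η ‖∇f‖²`: elapsed time plus dissipated energy.
  have speed_le (x : E) : ‖η x • -gradient f x‖ ≤ 1 + η x * ‖gradient f x‖ ^ 2 := by
    obtain ⟨h0, h1⟩ := hη x
    rw [norm_smul, norm_neg, Real.norm_of_nonneg h0]
    nlinarith [mul_nonneg h0 (sq_nonneg (‖gradient f x‖ - 1)),
      mul_nonneg h0 (sq_nonneg (‖gradient f x‖))]
  have right_nhds {t : ℝ} (ht : t ∈ Set.Ico 0 T) : Set.Icc 0 T ∈ 𝓝[Set.Ici t] t :=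
    Icc_mem_nhdsGE_of_mem ht
  intro t ht
  have dist_le : ‖γ t - γ 0‖ ≤ t + (f (γ 0) - f (γ t)) :=
    image_norm_le_of_norm_deriv_right_le_deriv_boundary' (f := fun t => γ t - γ 0)
      (fun t ht => ((hγ t ht).sub_const _).continuousWithinAt)
      (fun t ht => ((hγ t ⟨ht.1, ht.2.le⟩).mono_of_mem_nhdsWithin (right_nhds ht)).sub_const _)
      (by simp)
      (fun t ht => (deriv_budget t ht).continuousWithinAt)
      (fun t ht => (deriv_budget t ⟨ht.1, ht.2.le⟩).mono_of_mem_nhdsWithin (right_nhds ht))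
      (fun t _ => speed_le (γ t)) ht
  linarith [hf0 (γ t), ht.2]

theorem exists_lipschitzOnWith_closedBall {E F : Type*} [NormedAddCommGroup E] [NormedSpace ℝ E]
    [ProperSpace E] [NormedAddCommGroup F] [NormedSpace ℝ F]
    {g : E → F} (hg : ContDiff ℝ 1 g) (c : E) (R : ℝ) :
    ∃ K, LipschitzOnWith K g (Metric.closedBall c R) :=
  hg.contDiffOn.exists_lipschitzOnWith one_ne_zero (convex_closedBall c R)
    (isCompact_closedBall c R)

theorem exists_solution_of_lipschitz_of_bounded {E : Type*} [NormedAddCommGroup E]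
    [NormedSpace ℝ E] [CompleteSpace E] {v : E → E} {K L : NNReal}
    (hv : LipschitzWith K v) (hL : ∀ x, ‖v x‖ ≤ L) (x : E) {T : ℝ} (hT : 0 ≤ T) :
    ∃ γ : ℝ → E, γ 0 = x ∧ ∀ t ∈ Set.Icc 0 T, HasDerivWithinAt γ (v (γ t)) (Set.Icc 0 T) t := by
  have picardLindelof : IsPicardLindelof (fun _ => v) (tmin := 0) (tmax := T) ⟨0, le_rfl, hT⟩ x
      (L * T.toNNReal) 0 L K :=
    { lipschitzOnWith := fun _ _ => hv.lipschitzOnWith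
      continuousOn := fun _ _ => continuousOn_const
      norm_le := fun _ _ y _ => hL y
      mul_max_le := by simp [hT] }
  exact picardLindelof.exists_eq_forall_mem_Icc_hasDerivWithinAt₀

theorem eqOn_of_solutions {E : Type*} [NormedAddCommGroup E] [NormedSpace ℝ E] [ProperSpace E]
    {g : E → E} (hg : ContDiff ℝ 1 g) {γ δ : ℝ → E} {T : ℝ}
    (hγ : ∀ t ∈ Set.Icc 0 T, HasDerivWithinAt γ (g (γ t)) (Set.Icc 0 T) t)
    (hδ : ∀ t ∈ Set.Icc 0 T, HasDerivWithinAt δ (g (δ t)) (Set.Icc 0 T) t)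
    (h0 : γ 0 = δ 0) : Set.EqOn γ δ (Set.Icc 0 T) := by
  have hγc : ContinuousOn γ (Set.Icc 0 T) := fun t ht => (hγ t ht).continuousWithinAt
  have hδc : ContinuousOn δ (Set.Icc 0 T) := fun t ht => (hδ t ht).continuousWithinAt
  obtain ⟨R₁, hR₁⟩ := isCompact_Icc.exists_bound_of_continuousOn hγc
  obtain ⟨R₂, hR₂⟩ := isCompact_Icc.exists_bound_of_continuousOn hδc
  obtain ⟨K, hK⟩ := exists_lipschitzOnWith_closedBall hg 0 (max R₁ R₂)
  have right_deriv {η : ℝ → E}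
      (h : ∀ t ∈ Set.Icc 0 T, HasDerivWithinAt η (g (η t)) (Set.Icc 0 T) t) :
      ∀ t ∈ Set.Ico 0 T, HasDerivWithinAt η (g (η t)) (Set.Ici t) t := fun t ht =>
    (h t ⟨ht.1, ht.2.le⟩).mono_of_mem_nhdsWithin (Icc_mem_nhdsGE_of_mem ht)
  exact ODE_solution_unique_of_mem_Icc_right (v := fun _ => g)
    (s := fun _ => Metric.closedBall 0 (max R₁ R₂)) (K := K) (fun _ _ => hK)
    hγc (right_deriv hγ)
    (fun t ht => mem_closedBall_zero_iff.2 (le_max_of_le_left (hR₁ t ⟨ht.1, ht.2.le⟩)))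
    hδc (right_deriv hδ)
    (fun t ht => mem_closedBall_zero_iff.2 (le_max_of_le_right (hR₂ t ⟨ht.1, ht.2.le⟩))) h0

variable {E : Type*} [NormedAddCommGroup E] [InnerProductSpace ℝ E] [FiniteDimensional ℝ E]
  [CompleteSpace E]

/- Outside a large ball around `x` the field is cut off by a bump function; by
`norm_sub_le_of_damped_gradient_flow` the solution never reaches the cut-off region. -/
theorem exists_gradient_flow_Icc {f : E → ℝ} (hf : ContDiff ℝ 2 f)
    (hf0 : ∀ x, 0 ≤ f x) (x : E) {T : ℝ} (hT : 0 ≤ T) :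
    ∃ γ : ℝ → E, γ 0 = x ∧
      ∀ t ∈ Set.Icc 0 T, HasDerivWithinAt γ (-gradient f (γ t)) (Set.Icc 0 T) t := by
  have hpos : 0 < T + f x + 1 := by linarith [hf0 x]
  let η : ContDiffBump x := ⟨T + f x + 1, T + f x + 2, hpos, by linarith⟩
  have hsmooth : ContDiff ℝ 1 fun y => η y • -gradient f y :=
    η.contDiff.smul (contDiff_neg_gradient (by simpa [one_add_one_eq_two] using hf))
  have hsupp : HasCompactSupport fun y => η y • -gradient f y := η.hasCompactSupport.smul_right
  obtain ⟨K, hK⟩ := hsmooth.lipschitzWith_of_hasCompactSupport hsupp one_ne_zero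
  obtain ⟨L, hL⟩ := hsupp.exists_bound_of_continuous hsmooth.continuous
  obtain ⟨γ, hγ0, hγ⟩ := exists_solution_of_lipschitz_of_bounded hK (L := L.toNNReal)
    (fun y => (hL y).trans (Real.le_coe_toNNReal L)) x hT
  have dist_le := norm_sub_le_of_damped_gradient_flow (hf.differentiable two_ne_zero) hf0 (η := η)
    (fun y => ⟨η.nonneg, η.le_one⟩) hγ
  rw [hγ0] at dist_le
  refine ⟨γ, hγ0, fun t ht => ?_⟩
  have hη : η (γ t) = 1 := η.one_of_mem_closedBall
    (mem_closedBall_iff_norm.2 ((dist_le t ht).trans (le_add_of_nonneg_right zero_le_one)))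
  simpa only [hη, one_smul] using hγ t ht

theorem exists_isGradientFlowFrom {f : E → ℝ} (hf : ContDiff ℝ 2 f)
    (hf0 : ∀ x, 0 ≤ f x) (x : E) : ∃ γ : ℝ → E, IsGradientFlowFrom f x γ := by
  have hg : ContDiff ℝ 1 fun y => -gradient f y :=
    contDiff_neg_gradient (by simpa [one_add_one_eq_two] using hf)
  choose γ hγ0 hγ using fun n : ℕ => exists_gradient_flow_Icc hf hf0 x (T := n) n.cast_nonneg
  have compatible : ∀ m n : ℕ, m ≤ n → ∀ t ∈ Set.Icc (0 : ℝ) m, γ m t = γ n t := by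
    intro m n hmn
    have hsub : Set.Icc (0 : ℝ) m ⊆ Set.Icc (0 : ℝ) n :=
      Set.Icc_subset_Icc_right (by exact_mod_cast hmn)
    exact eqOn_of_solutions hg (hγ m) (fun t ht => (hγ n t (hsub ht)).mono hsub)
      (by rw [hγ0, hγ0])
  have glued_eq : ∀ (n : ℕ), ∀ t ∈ Set.Ico (0 : ℝ) n, γ (⌊t⌋₊ + 1) t = γ n t := fun n t ht =>
    compatible _ _ (Nat.succ_le_of_lt ((Nat.floor_lt ht.1).2 ht.2)) t
      ⟨ht.1, by push_cast; exact (Nat.lt_floor_add_one t).le⟩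
  refine ⟨fun t => γ (⌊t⌋₊ + 1) t, by simp [hγ0], fun t ht => ?_⟩
  obtain ⟨n, hn⟩ := exists_nat_gt t
  have deriv_n : HasDerivWithinAt (γ n) (-gradient f (γ n t)) (Set.Ici 0) t :=
    (hγ n t ⟨ht, hn.le⟩).mono_of_mem_nhdsWithin
      (mem_nhdsWithin.2 ⟨Set.Iio n, isOpen_Iio, hn, fun s hs => ⟨hs.2, le_of_lt hs.1⟩⟩)
  have eventually_eq : (fun t => γ (⌊t⌋₊ + 1) t) =ᶠ[𝓝[Set.Ici 0] t] γ n :=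
    mem_nhdsWithin.2 ⟨Set.Iio n, isOpen_Iio, hn, fun s hs => glued_eq n s ⟨hs.2, hs.1⟩⟩
  simp only [glued_eq n t ⟨ht, hn⟩]
  exact deriv_n.congr_of_eventuallyEq eventually_eq (glued_eq n t ⟨ht, hn⟩)

theorem isGradientFlowFrom_gradFlow {f : E → ℝ}
    (hf : ContDiff ℝ 2 f) (hf0 : ∀ x, 0 ≤ f x) (x : E) :
    IsGradientFlowFrom f x (gradFlow f x) := by
  have hex := exists_isGradientFlowFrom hf hf0 x
  have heq : gradFlow f x = hex.choose := funext fun _ => dif_pos hex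
  rw [heq]
  exact hex.choose_spec

end Existence

section Semiflow

theorem eq_zero_iff_of_norm_deriv_le {F : Type*} [NormedAddCommGroup F] [NormedSpace ℝ F]
    {f f' : ℝ → F} {K t : ℝ} (ht : 0 ≤ t)
    (hf : ∀ τ ∈ Set.Icc 0 t, HasDerivWithinAt f (f' τ) (Set.Icc 0 t) τ)
    (hle : ∀ τ ∈ Set.Icc 0 t, ‖f' τ‖ ≤ K * ‖f τ‖) : f t = 0 ↔ f 0 = 0 := by
  have forward {p p' : ℝ → F} (hp : ∀ τ ∈ Set.Icc 0 t, HasDerivWithinAt p (p' τ) (Set.Icc 0 t) τ)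
      (hle : ∀ τ ∈ Set.Icc 0 t, ‖p' τ‖ ≤ K * ‖p τ‖) (h0 : p 0 = 0) : p t = 0 :=
    eq_zero_of_abs_deriv_le_mul_abs_self_of_eq_zero_right
      (fun τ hτ => (hp τ hτ).continuousWithinAt)
      (fun τ hτ => (hp τ ⟨hτ.1, hτ.2.le⟩).mono_of_mem_nhdsWithin (Icc_mem_nhdsGE_of_mem hτ))
      h0 (fun τ hτ => hle τ ⟨hτ.1, hτ.2.le⟩) t ⟨ht, le_rfl⟩
  have reverse_mapsTo : Set.MapsTo (fun τ => t - τ) (Set.Icc 0 t) (Set.Icc 0 t) := fun τ hτ =>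
    ⟨sub_nonneg.2 hτ.2, sub_le_self t hτ.1⟩
  refine ⟨fun h => ?_, forward hf hle⟩
  have reversed := forward (p := fun τ => f (t - τ)) (p' := fun τ => -f' (t - τ))
    (fun τ hτ => by
      simpa [Function.comp_def] using (hf (t - τ) (reverse_mapsTo hτ)).scomp τ
        (((hasDerivAt_id τ).const_sub t).hasDerivWithinAt (s := Set.Icc 0 t)) reverse_mapsTo)
    (fun τ hτ => by simpa only [norm_neg] using hle (t - τ) (reverse_mapsTo hτ))
    (by simpa only [sub_zero] using h)
  simpa only [sub_self] using reversed

theorem norm_starProjection_orthogonal_le_of_lipschitzOnWith {E : Type*} [NormedAddCommGroup E]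
    [InnerProductSpace ℝ E] {V : Submodule ℝ E} [V.HasOrthogonalProjection] {g : E → E} {c y : E}
    {K : NNReal} {R : ℝ} (hK : LipschitzOnWith K g (Metric.closedBall c R))
    (hV : ∀ v ∈ V, g (c + v) ∈ V) (hy : ‖y - c‖ ≤ R) :
    ‖Vᗮ.starProjection (g y)‖ ≤ K * ‖Vᗮ.starProjection (y - c)‖ := by
  set v := V.starProjection (y - c)
  have hv : v ∈ V := V.starProjection_apply_mem _
  have tangent : Vᗮ.starProjection (g (c + v)) = 0 :=
    Submodule.starProjection_orthogonal_apply_eq_zero (hV v hv)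
  calc ‖Vᗮ.starProjection (g y)‖ = ‖Vᗮ.starProjection (g y - g (c + v))‖ := by
        rw [map_sub, tangent, sub_zero]
    _ ≤ ‖g y - g (c + v)‖ := Vᗮ.norm_starProjection_apply_le _
    _ ≤ K * ‖y - (c + v)‖ := hK.norm_sub_le (mem_closedBall_iff_norm.2 hy)
        (by simpa only [mem_closedBall_iff_norm, add_sub_cancel_left] using
          (V.norm_starProjection_apply_le (y - c)).trans hy)
    _ = K * ‖Vᗮ.starProjection (y - c)‖ := by
        rw [Submodule.starProjection_orthogonal_val, sub_add_eq_sub_sub]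

/-- `φ` is a global forward semiflow of the vector field `g`: `φ x` solves `γ' = g γ` on `[0, ∞)`
from `x`. It is also required to be bounded on bounded sets of initial points and times, which
for a general `g` does not follow from existence on `[0, ∞)` alone. -/
structure IsSemiflow {E : Type*} [NormedAddCommGroup E] [NormedSpace ℝ E]
    (g : E → E) (φ : E → ℝ → E) : Prop where
  zero : ∀ x, φ x 0 = x
  deriv : ∀ x t, 0 ≤ t → HasDerivWithinAt (φ x) (g (φ x t)) (Set.Ici 0) t
  bounded : ∀ r T : ℝ, ∃ R, ∀ x, ‖x‖ ≤ r → ∀ t ∈ Set.Icc 0 T, ‖φ x t‖ ≤ R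

theorem isSemiflow_gradFlow {E : Type*} [NormedAddCommGroup E] [InnerProductSpace ℝ E]
    [FiniteDimensional ℝ E] [CompleteSpace E] {f : E → ℝ}
    (hf : ContDiff ℝ 2 f) (hf0 : ∀ x, 0 ≤ f x) :
    IsSemiflow (fun x => -gradient f x) (gradFlow f) := by
  have hsol := isGradientFlowFrom_gradFlow hf hf0
  refine ⟨fun x => (hsol x).1, fun x => (hsol x).2, fun r T => ?_⟩
  obtain ⟨C, hC⟩ := (isCompact_closedBall (0 : E) r).exists_bound_of_continuousOn
    hf.continuous.continuousOn
  refine ⟨r + (T + C), fun x hx t ht => ?_⟩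
  have dist_le := norm_sub_le_of_damped_gradient_flow (hf.differentiable two_ne_zero) hf0
    (η := fun _ => 1) (γ := gradFlow f x) (fun _ => ⟨zero_le_one, le_rfl⟩)
    (fun t ht => by simpa using ((hsol x).2 t ht.1).mono Set.Icc_subset_Ici_self) t ht
  rw [(hsol x).1] at dist_le
  have energy_le : f x ≤ C := (le_abs_self _).trans (hC x (by simpa using hx))
  linarith [norm_le_norm_add_norm_sub' (gradFlow f x t) x]

namespace IsSemiflow

section NormedSpace

variable {E : Type*} [NormedAddCommGroup E] [NormedSpace ℝ E] {g : E → E} {φ : E → ℝ → E}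

theorem deriv_Icc (h : IsSemiflow g φ) (x : E) (T : ℝ) :
    ∀ t ∈ Set.Icc 0 T, HasDerivWithinAt (φ x) (g (φ x t)) (Set.Icc 0 T) t := fun t ht =>
  (h.deriv x t ht.1).mono Set.Icc_subset_Ici_self

theorem deriv_shift (h : IsSemiflow g φ) (x : E) (s : ℝ) {t : ℝ} (ht : s ≤ t) :
    HasDerivWithinAt (fun τ => φ x (τ - s)) (g (φ x (t - s))) (Set.Ici s) t := by
  simpa [Function.comp_def] using (h.deriv x (t - s) (sub_nonneg.2 ht)).scomp t
    (((hasDerivAt_id t).sub_const s).hasDerivWithinAt (s := Set.Ici s))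
    (fun τ hτ => by simpa using hτ)

variable [ProperSpace E]

theorem comp_add (h : IsSemiflow g φ) (hg : ContDiff ℝ 1 g) (x : E)
    {s t : ℝ} (hs : 0 ≤ s) (ht : 0 ≤ t) : φ (φ x s) t = φ x (s + t) := by
  refine eqOn_of_solutions hg (γ := φ (φ x s)) (δ := fun τ => φ x (s + τ)) (T := t)
    (h.deriv_Icc _ t) (fun τ hτ => ?_) (by simp [h.zero]) ⟨ht, le_rfl⟩
  simpa [Function.comp_def] using (h.deriv x (s + τ) (add_nonneg hs hτ.1)).scomp τ
    (((hasDerivAt_id τ).const_add s).hasDerivWithinAt (s := Set.Icc 0 t))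
    (fun r hr => add_nonneg hs hr.1)

theorem continuous (h : IsSemiflow g φ) (hg : ContDiff ℝ 1 g) {t : ℝ}
    (ht : 0 ≤ t) : Continuous fun x => φ x t := by
  refine continuous_iff_continuousAt.2 fun x => ?_
  obtain ⟨R, hR⟩ := h.bounded (‖x‖ + 1) t
  obtain ⟨K, hK⟩ := exists_lipschitzOnWith_closedBall hg 0 R
  have trajectory_continuousOn (y : E) : ContinuousOn (φ y) (Set.Icc 0 t) := fun τ hτ =>
    (h.deriv_Icc y t τ hτ).continuousWithinAt
  have trajectory_deriv (y : E) :
      ∀ τ ∈ Set.Ico 0 t, HasDerivWithinAt (φ y) (g (φ y τ)) (Set.Ici τ) τ :=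
    fun τ hτ => (h.deriv y τ hτ.1).mono (Set.Ici_subset_Ici.2 hτ.1)
  have trajectory_mem {y : E} (hy : ‖y‖ ≤ ‖x‖ + 1) :
      ∀ τ ∈ Set.Ico 0 t, φ y τ ∈ Metric.closedBall 0 R :=
    fun τ hτ => mem_closedBall_zero_iff.2 (hR y hy τ ⟨hτ.1, hτ.2.le⟩)
  have gronwall : ∀ y ∈ Metric.ball x 1,
      dist (φ y t) (φ x t) ≤ dist y x * Real.exp (K * (t - 0)) := by
    intro y hy
    have hy' : ‖y‖ ≤ ‖x‖ + 1 := (norm_le_norm_add_norm_sub' y x).trans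
      (add_le_add_right (mem_ball_iff_norm.1 hy).le _)
    exact dist_le_of_trajectories_ODE_of_mem (v := fun _ => g) (s := fun _ => Metric.closedBall 0 R)
      (fun _ _ => hK) (trajectory_continuousOn y) (trajectory_deriv y) (trajectory_mem hy')
      (trajectory_continuousOn x) (trajectory_deriv x) (trajectory_mem (by linarith))
      (by rw [h.zero, h.zero]) t ⟨ht, le_rfl⟩
  rw [ContinuousAt, tendsto_iff_dist_tendsto_zero]
  refine squeeze_zero' (Eventually.of_forall fun _ => dist_nonneg)
    (eventually_of_mem (Metric.ball_mem_nhds x one_pos) gronwall) ?_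
  have bound_continuous : Continuous fun y => dist y x * Real.exp (K * (t - 0)) := by fun_prop
  simpa using bound_continuous.tendsto x

end NormedSpace

theorem sub_mem_iff {E : Type*} [NormedAddCommGroup E] [InnerProductSpace ℝ E] [ProperSpace E]
    {g : E → E} {φ : E → ℝ → E} (h : IsSemiflow g φ) (hg : ContDiff ℝ 1 g) {V : Submodule ℝ E}
    [V.HasOrthogonalProjection] {c : E} (hV : ∀ v ∈ V, g (c + v) ∈ V) (x : E)
    {t : ℝ} (ht : 0 ≤ t) : φ x t - c ∈ V ↔ x - c ∈ V := by
  obtain ⟨R, hR⟩ := h.bounded ‖x‖ t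
  obtain ⟨K, hK⟩ := exists_lipschitzOnWith_closedBall hg c (R + ‖c‖)
  have mem_iff (y : E) : y ∈ V ↔ Vᗮ.starProjection y = 0 := by
    rw [Submodule.starProjection_apply_eq_zero_iff, Submodule.orthogonal_orthogonal]
  have transverse := eq_zero_iff_of_norm_deriv_le (f := fun τ => Vᗮ.starProjection (φ x τ - c)) ht
    (fun τ hτ => Vᗮ.starProjection.hasFDerivAt.comp_hasDerivWithinAt τ
      ((h.deriv_Icc x t τ hτ).sub_const c))
    (fun τ hτ => norm_starProjection_orthogonal_le_of_lipschitzOnWith hK hV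
      ((norm_sub_le _ _).trans (add_le_add_left (hR x le_rfl τ hτ) _)))
  rw [mem_iff, transverse, ← mem_iff, h.zero]

end IsSemiflow

end Semiflow

section Spectral

variable {E : Type*} [NormedAddCommGroup E] [InnerProductSpace ℝ E]

theorem exists_gap_below_of_finite {ι : Type*} [Finite ι] {f : ι → ℝ} {a : ℝ}
    (hf : ∀ i, f i ≤ a) : ∃ μ > 0, ∀ i, f i ≠ a → f i ≤ a - μ := by
  have eventually_gap (i : ι) : ∀ᶠ μ in 𝓝[>] (0 : ℝ), f i ≠ a → f i ≤ a - μ := by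
    by_cases hi : f i = a
    · exact Eventually.of_forall fun _ h => absurd hi h
    · filter_upwards [mem_nhdsWithin_of_mem_nhds
        (Iio_mem_nhds (sub_pos.2 (lt_of_le_of_ne (hf i) hi)))] with μ hμ _
      linarith [Set.mem_Iio.1 hμ]
  obtain ⟨μ, hμ, hμ0⟩ := ((eventually_all.2 eventually_gap).and self_mem_nhdsWithin).exists
  exact ⟨μ, hμ0, hμ⟩

theorem exists_gap_of_isTopEigenvalue [FiniteDimensional ℝ E] {L : E →L[ℝ] E}
    (hL : (L : E →ₗ[ℝ] E).IsSymmetric) {lam : ℝ} (htop : IsTopEigenvalue L lam) :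
    ∃ μ > 0, ∀ x ∈ (Module.End.eigenspace (L : E →ₗ[ℝ] E) lam)ᗮ,
      inner ℝ x (L x) ≤ (lam - μ) * ‖x‖ ^ 2 := by
  let b := hL.eigenvectorBasis rfl
  obtain ⟨μ, hμ, hgap⟩ := exists_gap_below_of_finite (f := hL.eigenvalues rfl) (a := lam)
    fun i => htop.2 (hL.hasEigenvalue_eigenvalues rfl i)
  refine ⟨μ, hμ, fun x hx => ?_⟩
  have coord_eq_zero (i) (hi : hL.eigenvalues rfl i = lam) : inner ℝ (b i) x = 0 :=
    Submodule.inner_right_of_mem_orthogonal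
      (Module.End.mem_eigenspace_iff.2 (hi ▸ hL.apply_eigenvectorBasis rfl i)) hx
  have coord_map (i) : inner ℝ (b i) (L x) = hL.eigenvalues rfl i * inner ℝ (b i) x := by
    rw [← ContinuousLinearMap.coe_coe, ← hL, hL.apply_eigenvectorBasis, inner_smul_left]
    rfl
  calc inner ℝ x (L x) = ∑ i, hL.eigenvalues rfl i * inner ℝ (b i) x ^ 2 := by
        rw [← b.sum_inner_mul_inner]
        exact Finset.sum_congr rfl fun i _ => by rw [coord_map, real_inner_comm]; ring
    _ ≤ ∑ i, (lam - μ) * inner ℝ (b i) x ^ 2 := by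
        refine Finset.sum_le_sum fun i _ => ?_
        by_cases hi : hL.eigenvalues rfl i = lam
        · rw [coord_eq_zero i hi]; simp
        · gcongr; exact hgap i hi
    _ = (lam - μ) * ‖x‖ ^ 2 := by
        rw [← Finset.mul_sum, ← b.sum_sq_norm_inner_right x]
        simp only [Real.norm_eq_abs, sq_abs]

/-- A spectral gap below the top of a symmetric operator: `L` acts as `lam > 0` on `W`, and its
quadratic form is at most `lam - μ` on the orthogonal complement of `W`. -/
structure IsTopSpectralSplit (L : E →L[ℝ] E) (W : Submodule ℝ E) (lam μ : ℝ) : Prop where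
  lam_pos : 0 < lam
  gap_pos : 0 < μ
  symm : (L : E →ₗ[ℝ] E).IsSymmetric
  eigen : ∀ x ∈ W, L x = lam • x
  gap : ∀ x ∈ Wᗮ, inner ℝ x (L x) ≤ (lam - μ) * ‖x‖ ^ 2

theorem exists_isTopSpectralSplit [FiniteDimensional ℝ E] {L : E →L[ℝ] E}
    (hL : (L : E →ₗ[ℝ] E).IsSymmetric) {lam : ℝ} (hpos : 0 < lam) (htop : IsTopEigenvalue L lam) :
    ∃ μ, IsTopSpectralSplit L (Module.End.eigenspace (L : E →ₗ[ℝ] E) lam) lam μ := by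
  obtain ⟨μ, hμ, hgap⟩ := exists_gap_of_isTopEigenvalue hL htop
  exact ⟨μ, hpos, hμ, hL, fun x hx => Module.End.mem_eigenspace_iff.1 hx, hgap⟩

namespace IsTopSpectralSplit

variable {L : E →L[ℝ] E} {W : Submodule ℝ E} {lam μ : ℝ}

theorem map_mem_orthogonal (h : IsTopSpectralSplit L W lam μ) {x : E} (hx : x ∈ Wᗮ) :
    L x ∈ Wᗮ := by
  rw [Submodule.mem_orthogonal] at hx ⊢
  intro u hu
  rw [← ContinuousLinearMap.coe_coe, ← h.symm, ContinuousLinearMap.coe_coe, h.eigen u hu,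
    inner_smul_left, hx u hu, mul_zero]

variable [W.HasOrthogonalProjection]

theorem starProjection_map (h : IsTopSpectralSplit L W lam μ) (x : E) :
    W.starProjection (L x) = lam • W.starProjection x := by
  conv_lhs => rw [← W.starProjection_add_starProjection_orthogonal x, map_add, map_add,
    h.eigen _ (W.starProjection_apply_mem x), map_smul]
  rw [Submodule.starProjection_eq_self_iff.2 (W.starProjection_apply_mem x),
    (Submodule.starProjection_apply_eq_zero_iff W).2
      (h.map_mem_orthogonal (Wᗮ.starProjection_apply_mem x)), add_zero]

theorem orthogonal_starProjection_map (h : IsTopSpectralSplit L W lam μ) (x : E) :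
    Wᗮ.starProjection (L x) = L (Wᗮ.starProjection x) := by
  rw [Submodule.starProjection_orthogonal_val, Submodule.starProjection_orthogonal_val,
    h.starProjection_map, map_sub, h.eigen _ (W.starProjection_apply_mem x)]

theorem inner_map_le (h : IsTopSpectralSplit L W lam μ) (x : E) :
    inner ℝ x (L x) ≤ lam * ‖x‖ ^ 2 := by
  set p := W.starProjection x
  set q := Wᗮ.starProjection x
  have hx : x = p + q := (W.starProjection_add_starProjection_orthogonal x).symm
  have hp : p ∈ W := W.starProjection_apply_mem x
  have hq : q ∈ Wᗮ := Wᗮ.starProjection_apply_mem x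
  have hpq : inner ℝ p q = 0 := Submodule.inner_right_of_mem_orthogonal hp hq
  have norm_sq : ‖x‖ ^ 2 = ‖p‖ ^ 2 + ‖q‖ ^ 2 := by
    rw [hx, norm_add_sq_real, hpq]; ring
  have form_split : inner ℝ x (L x) = lam * ‖p‖ ^ 2 + inner ℝ q (L q) := by
    rw [hx, map_add, h.eigen p hp, inner_add_left, inner_add_right, inner_add_right,
      inner_smul_right, inner_smul_right, real_inner_self_eq_norm_sq, real_inner_comm p q, hpq,
      Submodule.inner_right_of_mem_orthogonal hp (h.map_mem_orthogonal hq)]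
    ring
  rw [form_split, norm_sq]
  nlinarith [h.gap q hq, h.gap_pos, sq_nonneg ‖q‖]

end IsTopSpectralSplit

end Spectral

section Escape

theorem hasDerivAt_exp_const_mul (k t : ℝ) :
    HasDerivAt (fun t => Real.exp (k * t)) (Real.exp (k * t) * k) t := by
  simpa using ((hasDerivAt_id t).const_mul k).exp

theorem tendsto_exp_const_mul_atBot {k : ℝ} (hk : 0 < k) :
    Tendsto (fun t => Real.exp (k * t)) atBot (𝓝 0) :=
  Real.tendsto_exp_atBot.comp (tendsto_id.const_mul_atBot hk)

/-- The remainder of `g` after its first-order Taylor expansion at `c`, as a function of the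
displacement from `c`. -/
def taylorRemainder {E F : Type*} [NormedAddCommGroup E] [NormedSpace ℝ E] [NormedAddCommGroup F]
    [NormedSpace ℝ F] (g : E → F) (c x : E) : F :=
  g (c + x) - g c - fderiv ℝ g c x

theorem taylorRemainder_zero {E F : Type*} [NormedAddCommGroup E] [NormedSpace ℝ E]
    [NormedAddCommGroup F] [NormedSpace ℝ F] (g : E → F) (c : E) : taylorRemainder g c 0 = 0 := by
  simp [taylorRemainder]

theorem exists_norm_taylorRemainder_sub_le {E F : Type*} [NormedAddCommGroup E] [NormedSpace ℝ E]
    [ProperSpace E] [NormedAddCommGroup F] [NormedSpace ℝ F] {g : E → F} (hg : ContDiff ℝ 2 g)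
    (c : E) : ∃ C > 0, ∀ r ≤ (1 : ℝ), ∀ x y, ‖x‖ ≤ r → ‖y‖ ≤ r →
      ‖taylorRemainder g c x - taylorRemainder g c y‖ ≤ C * r * ‖x - y‖ := by
  obtain ⟨K, hK⟩ := exists_lipschitzOnWith_closedBall
    (hg.fderiv_right (m := 1) (by rw [one_add_one_eq_two])) c 1
  refine ⟨K + 1, by positivity, fun r hr x y hx hy => ?_⟩
  have deriv_remainder (z : E) : HasFDerivWithinAt (taylorRemainder g c)
      (fderiv ℝ g (c + z) - fderiv ℝ g c) (Metric.closedBall 0 r) z := by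
    have hgz : HasFDerivAt g (fderiv ℝ g (c + z)) (c + z) :=
      (hg.differentiable two_ne_zero (c + z)).hasFDerivAt
    exact (((hgz.comp z ((hasFDerivAt_id z).const_add c)).sub_const (g c)).sub
      (fderiv ℝ g c).hasFDerivAt).hasFDerivWithinAt
  have norm_deriv_le : ∀ z ∈ Metric.closedBall (0 : E) r,
      ‖fderiv ℝ g (c + z) - fderiv ℝ g c‖ ≤ (K + 1) * r := by
    intro z hz
    have hz := mem_closedBall_zero_iff.1 hz
    calc ‖fderiv ℝ g (c + z) - fderiv ℝ g c‖ ≤ K * ‖c + z - c‖ :=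
          hK.norm_sub_le (by simpa using hz.trans hr) (by simp)
      _ ≤ (K + 1) * r := by rw [add_sub_cancel_left]; gcongr; linarith
  exact (convex_closedBall (0 : E) r).norm_image_sub_le_of_norm_hasFDerivWithin_le
    (fun z _ => deriv_remainder z) norm_deriv_le (by simpa using hy) (by simpa using hx)

variable {E : Type*} [NormedAddCommGroup E]

/-- A curve of displacements from `c` that solves `x' = g (c + x)` from time `a` on, and starts
within the escape scale `R * exp (lam * a)`. For a trajectory that leaves `c` at rate `lam`, the
starting times `a → -∞` correspond to starting points that tend to `c`. -/
structure IsEscapingCurve [NormedSpace ℝ E] (g : E → E) (c : E) (lam R a : ℝ) (x : ℝ → E) :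
    Prop where
  deriv : ∀ t, a ≤ t → HasDerivWithinAt x (g (c + x t)) (Set.Ici a) t
  norm_start_le : ‖x a‖ ≤ R * Real.exp (lam * a)

theorem IsEscapingCurve.deriv_split [NormedSpace ℝ E] {g : E → E} {c : E} {lam R a : ℝ}
    {x : ℝ → E} (hx : IsEscapingCurve g c lam R a x) (hc : g c = 0) {t : ℝ} (ht : a ≤ t) :
    HasDerivWithinAt x (fderiv ℝ g c (x t) + taylorRemainder g c (x t)) (Set.Ici a) t :=
  (hx.deriv t ht).congr_deriv (by rw [taylorRemainder, hc, sub_zero, add_sub_cancel])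

/-- Near the critical point `c`, and up to time `b`, curves within the scale `R * exp (lam * t)`
stay in the region where the nonlinear terms, measured by `C`, are dominated by the linearization.
The fields `barrier` and `rate` are what the barriers in `IsEscapeScale.norm_le` and
`IsEscapeScale.norm_sub_le` need. -/
structure IsEscapeScale [NormedSpace ℝ E] (g : E → E) (c : E) (lam C R b : ℝ) : Prop where
  C_pos : 0 < C
  R_pos : 0 < R
  remainder : ∀ r ≤ (1 : ℝ), ∀ x y, ‖x‖ ≤ r → ‖y‖ ≤ r →
    ‖taylorRemainder g c x - taylorRemainder g c y‖ ≤ C * r * ‖x - y‖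
  crit : g c = 0
  barrier : (4 * C * R + 1) / lam * Real.exp (lam * b) ≤ 1
  small : 2 * R * Real.exp (lam * b) ≤ 1
  rate : C * (2 * R * Real.exp (lam * b)) ≤ lam / 4

theorem exists_isEscapeScale [NormedSpace ℝ E] [ProperSpace E] {g : E → E} {c : E} {lam R : ℝ}
    (hg : ContDiff ℝ 2 g) (hc : g c = 0) (hlam : 0 < lam) (hR : 0 < R) :
    ∃ C b, IsEscapeScale g c lam C R b := by
  obtain ⟨C, hC, hrem⟩ := exists_norm_taylorRemainder_sub_le hg c
  have eventually_le (k : ℝ) {δ : ℝ} (hδ : 0 < δ) :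
      ∀ᶠ b in atBot, k * Real.exp (lam * b) ≤ δ := by
    have htendsto := (tendsto_exp_const_mul_atBot hlam).const_mul k
    rw [mul_zero] at htendsto
    exact htendsto.eventually (ge_mem_nhds hδ)
  obtain ⟨b, hbarrier, hsmall, hrate⟩ := ((eventually_le ((4 * C * R + 1) / lam) one_pos).and
    ((eventually_le (2 * R) one_pos).and
      (eventually_le (C * (2 * R)) (δ := lam / 4) (by positivity)))).exists
  exact ⟨C, b, hC, hR, hrem, hc, hbarrier, hsmall, by rwa [← mul_assoc]⟩

namespace IsEscapeScale

section NormedSpace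

variable [NormedSpace ℝ E] {g : E → E} {c : E} {lam C R b : ℝ}

theorem norm_taylorRemainder_le (hs : IsEscapeScale g c lam C R b) {x : E} {r : ℝ} (hr : r ≤ 1)
    (hx : ‖x‖ ≤ r) : ‖taylorRemainder g c x‖ ≤ C * r ^ 2 := by
  have hr0 : 0 ≤ r := (norm_nonneg x).trans hx
  have hC := hs.C_pos
  have hsub := hs.remainder r hr x 0 hx (by simpa using hr0)
  rw [taylorRemainder_zero, sub_zero, sub_zero] at hsub
  calc ‖taylorRemainder g c x‖ ≤ C * r * ‖x‖ := hsub
    _ ≤ C * r * r := by gcongr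
    _ = C * r ^ 2 := by ring

theorem radius_le_one (hs : IsEscapeScale g c lam C R b) (hlam : 0 < lam) {t : ℝ} (ht : t ≤ b) :
    2 * R * Real.exp (lam * t) ≤ 1 := by
  have hR := hs.R_pos
  exact le_trans (by gcongr) hs.small

end NormedSpace

variable [InnerProductSpace ℝ E] {g : E → E} {c : E} {W : Submodule ℝ E} {lam μ C R a b : ℝ}
  [W.HasOrthogonalProjection]

theorem norm_le (hs : IsEscapeScale g c lam C R b)
    (hW : IsTopSpectralSplit (fderiv ℝ g c) W lam μ) {x : ℝ → E}
    (hx : IsEscapingCurve g c lam R a x) :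
    ∀ t ∈ Set.Icc a b, ‖x t‖ ≤ 2 * R * Real.exp (lam * t) := by
  have hlam := hW.lam_pos
  have hC := hs.C_pos
  have hR := hs.R_pos
  set D := (4 * C * R + 1) / lam with hD
  have : 0 < D := by positivity
  have hDlam : D * lam = 4 * C * R + 1 := by rw [hD]; field_simp
  let m : ℝ → ℝ := fun t => R * Real.exp (lam * t) * (1 + D * Real.exp (lam * t))
  have m_le : ∀ t ∈ Set.Icc a b, m t ≤ 2 * R * Real.exp (lam * t) := by
    intro t ht
    have hDt : D * Real.exp (lam * t) ≤ 1 := le_trans (by gcongr; exact ht.2) hs.barrier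
    calc m t ≤ R * Real.exp (lam * t) * (1 + 1) := by simp only [m]; gcongr
      _ = 2 * R * Real.exp (lam * t) := by ring
  have hm : ∀ t, HasDerivAt m (lam * m t + R * (D * lam) * Real.exp (lam * t) ^ 2) t := fun t =>
    (((hasDerivAt_exp_const_mul lam t).const_mul R).mul
      (((hasDerivAt_exp_const_mul lam t).const_mul D).const_add 1)).congr_deriv
      (by simp only [m]; ring)
  have start_le : ‖x a‖ ≤ m a :=
    hx.norm_start_le.trans (le_mul_of_one_le_right (by positivity)
      (le_add_of_nonneg_right (by positivity)))
  have norm_le_barrier := norm_le_of_perturbed_linear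
    (ρ := fun t => C * (2 * R * Real.exp (lam * t)) ^ 2)
    (fun t ht => hx.deriv_split hs.crit ht.1) (fun t _ => hW.inner_map_le (x t)) hm
    (fun t => by positivity) start_le
    (fun t ht hxt => hs.norm_taylorRemainder_le (hs.radius_le_one hlam ht.2)
      (hxt.le.trans (m_le t ht)))
    (fun t _ => by
      rw [hDlam]
      nlinarith [show 0 < R * Real.exp (lam * t) ^ 2 by positivity])
  exact fun t ht => (norm_le_barrier t ht).trans (m_le t ht)

theorem norm_taylorRemainder_curve_le (hs : IsEscapeScale g c lam C R b)
    (hW : IsTopSpectralSplit (fderiv ℝ g c) W lam μ) {x : ℝ → E}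
    (hx : IsEscapingCurve g c lam R a x) {t : ℝ} (ht : t ∈ Set.Icc a b) :
    ‖taylorRemainder g c (x t)‖ ≤ C * (2 * R * Real.exp (lam * t)) ^ 2 :=
  hs.norm_taylorRemainder_le (hs.radius_le_one hW.lam_pos ht.2) (hs.norm_le hW hx t ht)

theorem norm_starProjection_sub_le (hs : IsEscapeScale g c lam C R b)
    (hW : IsTopSpectralSplit (fderiv ℝ g c) W lam μ) {x : ℝ → E}
    (hx : IsEscapingCurve g c lam R a x) :
    ∀ t ∈ Set.Icc a b, ‖Real.exp (-lam * t) • W.starProjection (x t) -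
      Real.exp (-lam * a) • W.starProjection (x a)‖ ≤
        4 * C * R ^ 2 / lam * Real.exp (lam * t) := by
  have hlam := hW.lam_pos
  have hC := hs.C_pos
  have hderiv : ∀ t, a ≤ t → HasDerivWithinAt
      (fun t => Real.exp (-lam * t) • W.starProjection (x t))
      (Real.exp (-lam * t) • W.starProjection (taylorRemainder g c (x t))) (Set.Ici a) t := by
    intro t ht
    refine ((hasDerivAt_exp_const_mul (-lam) t).hasDerivWithinAt.smul
      (W.starProjection.hasFDerivAt.comp_hasDerivWithinAt t
        (hx.deriv_split hs.crit ht))).congr_deriv ?_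
    rw [Function.comp_apply, map_add, hW.starProjection_map]
    module
  refine image_norm_le_of_norm_deriv_right_le_deriv_boundary
    (f := fun t => Real.exp (-lam * t) • W.starProjection (x t) -
      Real.exp (-lam * a) • W.starProjection (x a))
    (B := fun t => 4 * C * R ^ 2 / lam * Real.exp (lam * t))
    (B' := fun t => 4 * C * R ^ 2 * Real.exp (lam * t))
    (fun t ht => ((hderiv t ht.1).continuousWithinAt.mono Set.Icc_subset_Ici_self).sub
      continuousWithinAt_const)
    (fun t ht => ((hderiv t ht.1).mono (Set.Ici_subset_Ici.2 ht.1)).sub_const _)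
    (by rw [sub_self, norm_zero]; positivity)
    (fun t => ((hasDerivAt_exp_const_mul lam t).const_mul _).congr_deriv (by field_simp))
    (fun t ht => ?_)
  calc ‖Real.exp (-lam * t) • W.starProjection (taylorRemainder g c (x t))‖
      ≤ Real.exp (-lam * t) * (C * (2 * R * Real.exp (lam * t)) ^ 2) := by
        rw [norm_smul, Real.norm_of_nonneg (Real.exp_pos _).le]
        gcongr
        exact (W.norm_starProjection_apply_le _).trans
          (hs.norm_taylorRemainder_curve_le hW hx ⟨ht.1, ht.2.le⟩)
    _ = Real.exp (-lam * t) * Real.exp (lam * t) * (4 * C * R ^ 2 * Real.exp (lam * t)) := by ring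
    _ = 4 * C * R ^ 2 * Real.exp (lam * t) := by
        rw [← Real.exp_add, neg_mul, neg_add_cancel, Real.exp_zero, one_mul]

theorem norm_orthogonal_starProjection_le (hs : IsEscapeScale g c lam C R b)
    (hW : IsTopSpectralSplit (fderiv ℝ g c) W lam μ) {x : ℝ → E}
    (hx : IsEscapingCurve g c lam R a x) :
    ∀ t ∈ Set.Icc a b, ‖Wᗮ.starProjection (x t)‖ ≤ Real.exp (lam * t) *
      (R * Real.exp (-μ * (t - a)) + (4 * C * R ^ 2 + 1) / lam * Real.exp (lam * t)) := by
  have hlam := hW.lam_pos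
  have hμ := hW.gap_pos
  have hC := hs.C_pos
  have hR := hs.R_pos
  set D := (4 * C * R ^ 2 + 1) / lam with hD
  have : 0 < D := by positivity
  have hDlam : D * lam = 4 * C * R ^ 2 + 1 := by rw [hD]; field_simp
  let m : ℝ → ℝ := fun t =>
    Real.exp (lam * t) * (R * Real.exp (-μ * (t - a)) + D * Real.exp (lam * t))
  have hm : ∀ t, HasDerivAt m
      ((lam - μ) * m t + (D * lam + μ * D) * Real.exp (lam * t) ^ 2) t := fun t =>
    ((hasDerivAt_exp_const_mul lam t).mul
      ((((hasDerivAt_exp_const_mul (-μ) (t - a)).comp_sub_const t a).const_mul R).add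
        ((hasDerivAt_exp_const_mul lam t).const_mul D))).congr_deriv
      (by simp only [m, Pi.add_apply]; ring)
  have start_le : ‖Wᗮ.starProjection (x a)‖ ≤ m a := by
    refine ((Wᗮ.norm_starProjection_apply_le _).trans hx.norm_start_le).trans ?_
    have : 0 < Real.exp (lam * a) * (D * Real.exp (lam * a)) := by positivity
    simp only [m, sub_self, mul_zero, Real.exp_zero, mul_one]
    linarith
  exact norm_le_of_perturbed_linear (L := fderiv ℝ g c)
    (q := fun t => Wᗮ.starProjection (taylorRemainder g c (x t)))
    (ρ := fun t => C * (2 * R * Real.exp (lam * t)) ^ 2)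
    (fun t ht => by
      rw [← hW.orthogonal_starProjection_map, ← map_add]
      exact Wᗮ.starProjection.hasFDerivAt.comp_hasDerivWithinAt t (hx.deriv_split hs.crit ht.1))
    (fun t _ => hW.gap _ (Wᗮ.starProjection_apply_mem _)) hm (fun t => by positivity) start_le
    (fun t ht _ => (Wᗮ.norm_starProjection_apply_le _).trans
      (hs.norm_taylorRemainder_curve_le hW hx ht))
    (fun t _ => by
      rw [hDlam]
      nlinarith [show 0 < (1 + μ * D) * Real.exp (lam * t) ^ 2 by positivity])

theorem norm_sub_le (hs : IsEscapeScale g c lam C R b)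
    (hW : IsTopSpectralSplit (fderiv ℝ g c) W lam μ) {a' : ℝ} {x y : ℝ → E}
    (hx : IsEscapingCurve g c lam R a x) (hy : IsEscapingCurve g c lam R a' y) {s δ : ℝ}
    (has : a ≤ s) (has' : a' ≤ s) (hδ : 0 < δ) (hxy : ‖x s - y s‖ ≤ δ) :
    ∀ t ∈ Set.Icc s b, ‖x t - y t‖ ≤ δ * Real.exp (3 / 2 * lam * (t - s)) := by
  have hlam := hW.lam_pos
  have := hs.C_pos
  have hR := hs.R_pos
  let m : ℝ → ℝ := fun t => δ * Real.exp (3 / 2 * lam * (t - s))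
  have curve_le {a : ℝ} {x : ℝ → E} (hx : IsEscapingCurve g c lam R a x) (has : a ≤ s) {t : ℝ}
      (ht : t ∈ Set.Icc s b) : ‖x t‖ ≤ 2 * R * Real.exp (lam * b) :=
    (hs.norm_le hW hx t ⟨has.trans ht.1, ht.2⟩).trans (by gcongr; exact ht.2)
  refine norm_le_of_perturbed_linear (L := fderiv ℝ g c) (m := m)
    (q := fun t => taylorRemainder g c (x t) - taylorRemainder g c (y t))
    (ρ := fun t => lam / 4 * m t) (fun t ht => ?_) (fun t _ => hW.inner_map_le _)
    (fun t => (((hasDerivAt_exp_const_mul _ (t - s)).comp_sub_const t s).const_mul δ))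
    (fun t => by positivity) (by simpa [m] using hxy) (fun t ht hxyt => ?_) (fun t _ => ?_)
  · refine (((hx.deriv_split hs.crit (has.trans ht.1)).mono (Set.Ici_subset_Ici.2 has)).sub
      ((hy.deriv_split hs.crit (has'.trans ht.1)).mono (Set.Ici_subset_Ici.2 has'))).congr_deriv ?_
    rw [map_sub, add_sub_add_comm]
  · calc _ ≤ C * (2 * R * Real.exp (lam * b)) * ‖x t - y t‖ :=
          hs.remainder _ hs.small (x t) (y t) (curve_le hx has ht) (curve_le hy has' ht)
      _ ≤ lam / 4 * m t := by rw [hxyt]; gcongr; exact hs.rate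
  · simp only [m]
    nlinarith [show 0 < lam * (δ * Real.exp (3 / 2 * lam * (t - s))) by positivity]

theorem norm_exp_smul_sub_le (hs : IsEscapeScale g c lam C R b)
    (hW : IsTopSpectralSplit (fderiv ℝ g c) W lam μ) {x : ℝ → E}
    (hx : IsEscapingCurve g c lam R a x) {t : ℝ} (ht : t ∈ Set.Icc a b) :
    ‖Real.exp (-lam * t) • x t - Real.exp (-lam * a) • W.starProjection (x a)‖ ≤
      R * Real.exp (-μ * (t - a)) + 2 * ((4 * C * R ^ 2 + 1) / lam) * Real.exp (lam * t) := by
  have hlam := hW.lam_pos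
  have orthogonal_le : ‖Real.exp (-lam * t) • Wᗮ.starProjection (x t)‖ ≤
      R * Real.exp (-μ * (t - a)) + (4 * C * R ^ 2 + 1) / lam * Real.exp (lam * t) := by
    rw [norm_smul, Real.norm_of_nonneg (Real.exp_pos _).le]
    refine (mul_le_mul_of_nonneg_left (hs.norm_orthogonal_starProjection_le hW hx t ht)
      (Real.exp_pos _).le).trans ?_
    rw [← mul_assoc, ← Real.exp_add, neg_mul, neg_add_cancel, Real.exp_zero, one_mul]
  have constant_le : 4 * C * R ^ 2 / lam * Real.exp (lam * t) ≤
      (4 * C * R ^ 2 + 1) / lam * Real.exp (lam * t) := by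
    gcongr
    linarith
  have decomposition : Real.exp (-lam * t) • x t - Real.exp (-lam * a) • W.starProjection (x a) =
      (Real.exp (-lam * t) • W.starProjection (x t) -
        Real.exp (-lam * a) • W.starProjection (x a)) +
      Real.exp (-lam * t) • Wᗮ.starProjection (x t) := by
    conv_lhs => rw [← W.starProjection_add_starProjection_orthogonal (x t), smul_add]
    abel
  rw [decomposition]
  linarith [norm_add_le (Real.exp (-lam * t) • W.starProjection (x t) -
    Real.exp (-lam * a) • W.starProjection (x a)) (Real.exp (-lam * t) • Wᗮ.starProjection (x t)),
    hs.norm_starProjection_sub_le hW hx t ht]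

end IsEscapeScale

end Escape

section EscapeLimit

/-- The trajectory of `φ` released at time `σ` from `c + exp (lam * σ) • θ`. As `σ → -∞` the
release points tend to `c` along the ray spanned by `θ`, at the rate at which trajectories leave
`c`. -/
def releasedCurve {E : Type*} [AddCommGroup E] [Module ℝ E] (φ : E → ℝ → E) (c : E) (lam : ℝ)
    (θ : E) (σ t : ℝ) : E :=
  φ (c + Real.exp (lam * σ) • θ) (t - σ)

theorem tendsto_of_tendsto_releasedCurve {E : Type*} [AddCommGroup E] [Module ℝ E]
    [TopologicalSpace E] {φ : E → ℝ → E} {c θ y : E} {lam t : ℝ} (hlam : 0 < lam)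
    (h : Tendsto (fun σ => releasedCurve φ c lam θ σ t) atBot (𝓝 y)) :
    Tendsto (fun a => φ (c + a • θ) (t + 1 / lam * Real.log (1 / a))) (𝓝[>] 0) (𝓝 y) := by
  refine (h.comp (Real.tendsto_log_nhdsGT_zero.atBot_div_const hlam)).congr' ?_
  filter_upwards [self_mem_nhdsWithin] with a ha
  rw [Function.comp_apply, releasedCurve, mul_div_cancel₀ _ hlam.ne', Real.exp_log ha, one_div a,
    Real.log_inv]
  congr 1
  ring

/-- The entire trajectory `z` of `φ` escapes from `c` at rate `lam` along `v`: it is the limit of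
the trajectories released closer and closer to `c`, and `z t = c + exp (lam * t) • (v + o(1))` as
`t → -∞`. -/
structure IsEscapeOrbit {E : Type*} [NormedAddCommGroup E] [NormedSpace ℝ E] (φ : E → ℝ → E)
    (c : E) (lam : ℝ) (v : E) (z : ℝ → E) : Prop where
  tendsto : ∀ t, Tendsto (fun σ => releasedCurve φ c lam v σ t) atBot (𝓝 (z t))
  flow : ∀ s t, s ≤ t → z t = φ (z s) (t - s)
  asymptotic : Tendsto (fun t => Real.exp (-lam * t) • (z t - c)) atBot (𝓝 v)

section NormedSpace

variable {E : Type*} [NormedAddCommGroup E] [NormedSpace ℝ E] {g : E → E} {φ : E → ℝ → E} {c : E}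
  {lam : ℝ}

theorem releasedCurve_self (hφ : IsSemiflow g φ) (θ : E) (σ : ℝ) :
    releasedCurve φ c lam θ σ σ = c + Real.exp (lam * σ) • θ := by
  rw [releasedCurve, sub_self, hφ.zero]

theorem isEscapingCurve_releasedCurve (hφ : IsSemiflow g φ) {θ : E} {R : ℝ} (hθ : ‖θ‖ ≤ R)
    (σ : ℝ) : IsEscapingCurve g c lam R σ fun t => releasedCurve φ c lam θ σ t - c where
  deriv t ht := by
    simpa [releasedCurve] using (hφ.deriv_shift (c + Real.exp (lam * σ) • θ) σ ht).sub_const c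
  norm_start_le := by
    rw [releasedCurve_self hφ, add_sub_cancel_left, norm_smul,
      Real.norm_of_nonneg (Real.exp_pos _).le, mul_comm]
    gcongr

theorem tendsto_releasedCurve_of_le [ProperSpace E] (hφ : IsSemiflow g φ) (hg : ContDiff ℝ 1 g)
    {θ y : E} {s t : ℝ} (hst : s ≤ t)
    (hy : Tendsto (fun σ => releasedCurve φ c lam θ σ s) atBot (𝓝 y)) :
    Tendsto (fun σ => releasedCurve φ c lam θ σ t) atBot (𝓝 (φ y (t - s))) := by
  refine (((hφ.continuous hg (sub_nonneg.2 hst)).tendsto y).comp hy).congr' ?_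
  filter_upwards [eventually_le_atBot s] with σ hσ
  rw [Function.comp_apply, releasedCurve, releasedCurve,
    hφ.comp_add hg _ (sub_nonneg.2 hσ) (sub_nonneg.2 hst), sub_add_sub_cancel']

end NormedSpace

variable {E : Type*} [NormedAddCommGroup E] [InnerProductSpace ℝ E]
  {g : E → E} {φ : E → ℝ → E} {c : E} {W : Submodule ℝ E} [W.HasOrthogonalProjection]
  {lam μ C R b : ℝ}

theorem eventually_norm_exp_smul_releasedCurve_sub_le (hφ : IsSemiflow g φ)
    (hs : IsEscapeScale g c lam C R b) (hW : IsTopSpectralSplit (fderiv ℝ g c) W lam μ) {θ : E}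
    (hθ : ‖θ‖ ≤ R) {t : ℝ} (ht : t ≤ b) :
    ∀ᶠ σ in atBot, ‖Real.exp (-lam * t) • (releasedCurve φ c lam θ σ t - c) -
      W.starProjection θ‖ ≤ 3 * ((4 * C * R ^ 2 + 1) / lam) * Real.exp (lam * t) := by
  have hlam := hW.lam_pos
  have hC := hs.C_pos
  set D := (4 * C * R ^ 2 + 1) / lam
  have : 0 < D := by positivity
  have transient : Tendsto (fun σ => R * Real.exp (-μ * (t - σ))) atBot (𝓝 0) := by
    have hexp := (tendsto_exp_const_mul_atBot hW.gap_pos).const_mul (R * Real.exp (-μ * t))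
    rw [mul_zero] at hexp
    refine hexp.congr fun σ => ?_
    rw [mul_assoc, ← Real.exp_add]
    ring_nf
  have transient_le : ∀ᶠ σ in atBot, R * Real.exp (-μ * (t - σ)) ≤ D * Real.exp (lam * t) :=
    transient.eventually (ge_mem_nhds (by positivity))
  filter_upwards [transient_le, eventually_le_atBot t] with σ hσ hσt
  have hbound := hs.norm_exp_smul_sub_le hW (isEscapingCurve_releasedCurve hφ hθ σ) ⟨hσt, ht⟩
  rw [releasedCurve_self hφ, add_sub_cancel_left, map_smul, smul_smul, ← Real.exp_add, neg_mul lam,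
    neg_mul lam, neg_add_cancel, Real.exp_zero, one_smul, ← neg_mul] at hbound
  linarith

theorem eventually_norm_releasedCurve_sub_le (hφ : IsSemiflow g φ)
    (hs : IsEscapeScale g c lam C R b) (hW : IsTopSpectralSplit (fderiv ℝ g c) W lam μ) {θ θ' : E}
    (hθ : ‖θ‖ ≤ R) (hθ' : ‖θ'‖ ≤ R) (hP : W.starProjection θ = W.starProjection θ')
    {s : ℝ} (hsb : s ≤ b) :
    ∀ᶠ p : ℝ × ℝ in atBot ×ˢ atBot,
      ‖releasedCurve φ c lam θ p.1 s - c - (releasedCurve φ c lam θ' p.2 s - c)‖ ≤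
        6 * ((4 * C * R ^ 2 + 1) / lam) * Real.exp (lam * s) ^ 2 := by
  filter_upwards [(eventually_norm_exp_smul_releasedCurve_sub_le hφ hs hW hθ hsb).prod_mk
    (eventually_norm_exp_smul_releasedCurve_sub_le hφ hs hW hθ' hsb)] with p ⟨hp, hp'⟩
  set x := releasedCurve φ c lam θ p.1 s - c
  set y := releasedCurve φ c lam θ' p.2 s - c
  have rescaled_le : ‖Real.exp (-lam * s) • (x - y)‖ ≤
      6 * ((4 * C * R ^ 2 + 1) / lam) * Real.exp (lam * s) := by
    have hsub : Real.exp (-lam * s) • (x - y) = (Real.exp (-lam * s) • x - W.starProjection θ) -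
        (Real.exp (-lam * s) • y - W.starProjection θ') := by
      rw [hP, smul_sub]
      abel
    rw [hsub]
    exact (norm_sub_le _ _).trans (by linarith)
  rwa [norm_smul, Real.norm_of_nonneg (Real.exp_pos _).le, neg_mul, Real.exp_neg,
    inv_mul_le_iff₀' (Real.exp_pos _), mul_assoc, ← sq] at rescaled_le

/- At an early time `s` the two trajectories are within `O(exp (2 * lam * s))` of each other, and
from then on they separate at rate at most `3 / 2 * lam`, so that at the fixed time `t` their
distance is `O(exp (lam / 2 * s))`. -/
theorem tendsto_dist_releasedCurve (hφ : IsSemiflow g φ) (hs : IsEscapeScale g c lam C R b)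
    (hW : IsTopSpectralSplit (fderiv ℝ g c) W lam μ) {θ θ' : E} (hθ : ‖θ‖ ≤ R) (hθ' : ‖θ'‖ ≤ R)
    (hP : W.starProjection θ = W.starProjection θ') {t : ℝ} (ht : t ≤ b) :
    Tendsto (fun p : ℝ × ℝ => dist (releasedCurve φ c lam θ p.1 t) (releasedCurve φ c lam θ' p.2 t))
      (atBot ×ˢ atBot) (𝓝 0) := by
  have hlam := hW.lam_pos
  have hC := hs.C_pos
  set D := 6 * ((4 * C * R ^ 2 + 1) / lam) with hD
  have : 0 < D := by positivity
  refine Metric.tendsto_nhds.2 fun ε hε => ?_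
  have bound_tendsto : Tendsto (fun s => D * Real.exp (3 / 2 * lam * t) * Real.exp (lam / 2 * s))
      atBot (𝓝 0) := by
    simpa using (tendsto_exp_const_mul_atBot (half_pos hlam)).const_mul
      (D * Real.exp (3 / 2 * lam * t))
  obtain ⟨s, hsε, hst⟩ :=
    ((bound_tendsto.eventually (gt_mem_nhds hε)).and (eventually_le_atBot t)).exists
  filter_upwards [eventually_norm_releasedCurve_sub_le hφ hs hW hθ hθ' hP (hst.trans ht),
    (eventually_le_atBot s).prod_mk (eventually_le_atBot s)] with p hp ⟨hp1, hp2⟩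
  have dist_le := hs.norm_sub_le hW (isEscapingCurve_releasedCurve hφ hθ p.1)
    (isEscapingCurve_releasedCurve hφ hθ' p.2) hp1 hp2 (by positivity) hp t ⟨hst, ht⟩
  have exponents : Real.exp (lam * s) ^ 2 * Real.exp (3 / 2 * lam * (t - s)) =
      Real.exp (3 / 2 * lam * t) * Real.exp (lam / 2 * s) := by
    rw [← Real.exp_nat_mul, ← Real.exp_add, ← Real.exp_add]
    ring_nf
  rw [← hD, mul_assoc D, exponents, ← mul_assoc D, sub_sub_sub_cancel_right,
    ← dist_eq_norm] at dist_le
  rw [Real.dist_0_eq_abs, abs_of_nonneg dist_nonneg]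
  exact dist_le.trans_lt hsε

theorem exists_tendsto_releasedCurve [ProperSpace E] (hφ : IsSemiflow g φ) (hg : ContDiff ℝ 1 g)
    (hs : IsEscapeScale g c lam C R b) (hW : IsTopSpectralSplit (fderiv ℝ g c) W lam μ) {θ : E}
    (hθ : ‖θ‖ ≤ R) :
    ∃ z : ℝ → E, ∀ t, Tendsto (fun σ => releasedCurve φ c lam θ σ t) atBot (𝓝 (z t)) ∧
      Tendsto (fun σ => releasedCurve φ c lam (W.starProjection θ) σ t) atBot (𝓝 (z t)) := by
  suffices h : ∀ t, ∃ y, Tendsto (fun σ => releasedCurve φ c lam θ σ t) atBot (𝓝 y) ∧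
      Tendsto (fun σ => releasedCurve φ c lam (W.starProjection θ) σ t) atBot (𝓝 y) by
    choose z hz using h
    exact ⟨z, hz⟩
  have early : ∀ t ≤ b, ∃ y, Tendsto (fun σ => releasedCurve φ c lam θ σ t) atBot (𝓝 y) ∧
      Tendsto (fun σ => releasedCurve φ c lam (W.starProjection θ) σ t) atBot (𝓝 y) := by
    intro t ht
    have cauchy : Cauchy (map (fun σ => releasedCurve φ c lam θ σ t) atBot) := by
      refine cauchy_map_iff.2 ⟨inferInstance, ?_⟩
      exact tendsto_uniformity_iff_dist_tendsto_zero.2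
        (tendsto_dist_releasedCurve hφ hs hW hθ hθ rfl ht)
    obtain ⟨y, hy⟩ := cauchy_map_iff_exists_tendsto.1 cauchy
    have merge := (tendsto_dist_releasedCurve hφ hs hW hθ
      ((W.norm_starProjection_apply_le θ).trans hθ)
      (Submodule.starProjection_eq_self_iff.2 (W.starProjection_apply_mem θ)).symm ht).comp
      (tendsto_id.prodMk (tendsto_id (x := atBot)))
    exact ⟨y, hy, (tendsto_iff_of_dist merge).1 hy⟩
  intro t
  obtain ⟨y, hy, hy'⟩ := early (min t b) (min_le_right _ _)
  exact ⟨_, tendsto_releasedCurve_of_le hφ hg (min_le_left _ _) hy,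
    tendsto_releasedCurve_of_le hφ hg (min_le_left _ _) hy'⟩

theorem exists_isEscapeOrbit [ProperSpace E] (hφ : IsSemiflow g φ) (hg : ContDiff ℝ 2 g)
    (hc : g c = 0) (hW : IsTopSpectralSplit (fderiv ℝ g c) W lam μ) (θ : E) :
    ∃ z : ℝ → E, IsEscapeOrbit φ c lam (W.starProjection θ) z ∧
      ∀ t, Tendsto (fun σ => releasedCurve φ c lam θ σ t) atBot (𝓝 (z t)) := by
  have hg1 : ContDiff ℝ 1 g := hg.of_le one_le_two
  have hθ : ‖θ‖ ≤ ‖θ‖ + 1 := le_add_of_nonneg_right zero_le_one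
  obtain ⟨C, b, hs⟩ := exists_isEscapeScale hg hc hW.lam_pos (R := ‖θ‖ + 1) (by positivity)
  obtain ⟨z, hz⟩ := exists_tendsto_releasedCurve hφ hg1 hs hW hθ
  refine ⟨z, ⟨fun t => (hz t).2, fun s t hst => tendsto_nhds_unique (hz t).1
    (tendsto_releasedCurve_of_le hφ hg1 hst (hz s).1), ?_⟩, fun t => (hz t).1⟩
  set D := 3 * ((4 * C * (‖θ‖ + 1) ^ 2 + 1) / lam)
  have dist_le : ∀ t ≤ b, dist (Real.exp (-lam * t) • (z t - c)) (W.starProjection θ) ≤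
      D * Real.exp (lam * t) := by
    intro t ht
    rw [dist_eq_norm]
    exact le_of_tendsto (((((hz t).1.sub_const c).const_smul _).sub_const _).norm)
      (eventually_norm_exp_smul_releasedCurve_sub_le hφ hs hW hθ ht)
  rw [tendsto_iff_dist_tendsto_zero]
  refine squeeze_zero' (Eventually.of_forall fun _ => dist_nonneg)
    ((eventually_le_atBot b).mono dist_le) ?_
  simpa using (tendsto_exp_const_mul_atBot hW.lam_pos).const_mul D

namespace IsEscapeOrbit

variable {v : E} {z : ℝ → E}

theorem tendsto_atBot (hz : IsEscapeOrbit φ c lam v z) (hlam : 0 < lam) :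
    Tendsto z atBot (𝓝 c) := by
  have hprod := ((tendsto_exp_const_mul_atBot hlam).smul hz.asymptotic).add_const c
  rw [zero_smul, zero_add] at hprod
  refine hprod.congr fun t => ?_
  rw [smul_smul, ← Real.exp_add, neg_mul, add_neg_cancel, Real.exp_zero, one_smul, sub_add_cancel]

variable [FiniteDimensional ℝ E] {V : Submodule ℝ E} {e : E}

theorem sub_mem_iff (hz : IsEscapeOrbit φ c lam v z) (hφ : IsSemiflow g φ) (hg : ContDiff ℝ 1 g)
    (hV : ∀ x ∈ V, g (e + x) ∈ V) {s t : ℝ} (hst : s ≤ t) : z t - e ∈ V ↔ z s - e ∈ V := by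
  rw [hz.flow s t hst, hφ.sub_mem_iff hg hV _ (sub_nonneg.2 hst)]

theorem sub_mem (hz : IsEscapeOrbit φ c lam v z) (hφ : IsSemiflow g φ) (hg : ContDiff ℝ 1 g)
    (hV : ∀ x ∈ V, g (e + x) ∈ V) (hc : c - e ∈ V) (hv : v ∈ V) (t : ℝ) : z t - e ∈ V := by
  refine V.closed_of_finiteDimensional.mem_of_tendsto ((hz.tendsto t).sub_const e) ?_
  filter_upwards [eventually_le_atBot t] with σ hσ
  rw [SetLike.mem_coe, releasedCurve, hφ.sub_mem_iff hg hV _ (sub_nonneg.2 hσ),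
    add_sub_right_comm]
  exact V.add_mem hc (V.smul_mem _ hv)

end IsEscapeOrbit

end EscapeLimit

section Parameters

variable {d : ℕ}

/-- `augMatrix` as a linear equivalence: a parameter is determined by its augmented matrix, which is
arbitrary. -/
def augEquiv (d : ℕ) : Param d ≃ₗ[ℝ] Matrix (Fin d ⊕ Fin d) (Fin d) ℝ where
  toFun := augMatrix
  invFun X := WithLp.toLp 2 (Sum.elim (fun p => X (Sum.inl p.1) p.2) fun p => X (Sum.inr p.2) p.1)
  left_inv θ := by
    ext (p | p) <;> rfl
  right_inv X := by
    ext (i | j) l <;> rfl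
  map_add' θ η := by
    ext (i | j) l <;> rfl
  map_smul' r θ := by
    ext (i | j) l <;> rfl

theorem augMatrix_zero : augMatrix (0 : Param d) = 0 :=
  map_zero (augEquiv d)

theorem augMatrix_add (θ η : Param d) : augMatrix (θ + η) = augMatrix θ + augMatrix η :=
  map_add (augEquiv d) θ η

theorem augMatrix_sub (θ η : Param d) : augMatrix (θ - η) = augMatrix θ - augMatrix η :=
  map_sub (augEquiv d) θ η

theorem augMatrix_smul (r : ℝ) (θ : Param d) : augMatrix (r • θ) = r • augMatrix θ :=
  map_smul (augEquiv d) r θ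

theorem continuous_augMatrix : Continuous (augMatrix : Param d → _) :=
  (augEquiv d).toLinearMap.continuous_of_finiteDimensional

theorem inner_eq_trace (θ η : Param d) :
    inner ℝ θ η = ((augMatrix θ)ᵀ * augMatrix η).trace := by
  rw [PiLp.inner_apply, Fintype.sum_sum_type, Fintype.sum_prod_type, Fintype.sum_prod_type_right,
    Matrix.trace]
  simp only [Matrix.diag_apply, Matrix.mul_apply, Fintype.sum_sum_type, Finset.sum_add_distrib]
  congr 1 <;> rw [Finset.sum_comm] <;> simp [augMatrix, factorA, factorB, mul_comm]

/-- The derivative of `(A, B) ↦ A * B` at `θ` in the direction `v`. It is a symmetric bilinear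
function of `θ` and `v`. -/
def firstVariation (θ v : Param d) : Matrix (Fin d) (Fin d) ℝ :=
  factorA v * factorB θ + factorA θ * factorB v

theorem firstVariation_comm (θ v : Param d) : firstVariation θ v = firstVariation v θ :=
  add_comm _ _

theorem firstVariation_add_smul (θ v η : Param d) (s : ℝ) :
    firstVariation (θ + s • v) η = firstVariation θ η + s • firstVariation v η := by
  change factorA η * (factorB θ + s • factorB v) + (factorA θ + s • factorA v) * factorB η = _
  simp only [firstVariation, mul_add, add_mul, Matrix.mul_smul, Matrix.smul_mul, smul_add]
  abel

theorem hasDerivAt_factorA_mul_factorB (θ v : Param d) (i j : Fin d) :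
    HasDerivAt (fun s : ℝ => (factorA (θ + s • v) * factorB (θ + s • v)) i j)
      (firstVariation θ v i j) 0 := by
  have hentry (p) : HasDerivAt (fun s : ℝ => (θ + s • v) p) (v p) 0 := by
    simpa using ((hasDerivAt_id (0 : ℝ)).mul_const (v p)).const_add (θ p)
  refine (HasDerivAt.fun_sum (u := Finset.univ) fun l _ =>
    (hentry (Sum.inl (i, l))).fun_mul (hentry (Sum.inr (l, j)))).congr_deriv ?_
  simp [firstVariation, factorA, factorB, Matrix.mul_apply, Finset.sum_add_distrib]

/-- The symmetric dilation `[[0, -X], [-Xᵀ, 0]]` of `X`. -/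
def dilation {m n : Type*} (X : Matrix m n ℝ) : Matrix (m ⊕ n) (m ⊕ n) ℝ :=
  Matrix.fromBlocks 0 (-X) (-Xᵀ) 0

theorem dilation_transpose {m n : Type*} (X : Matrix m n ℝ) : (dilation X)ᵀ = dilation X := by
  simp [dilation, Matrix.fromBlocks_transpose]

theorem trace_transpose_mul_dilation_mul (X : Matrix (Fin d) (Fin d) ℝ) (θ v : Param d) :
    ((augMatrix θ)ᵀ * dilation X * augMatrix v).trace = -(Xᵀ * firstVariation θ v).trace := by
  have transposed : ((factorA θ)ᵀ * (X * (factorB v)ᵀ)).trace =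
      (factorB v * (Xᵀ * factorA θ)).trace := by
    rw [← Matrix.trace_transpose]
    simp only [Matrix.transpose_mul, Matrix.transpose_transpose, Matrix.mul_assoc]
  rw [Matrix.mul_assoc, augMatrix, augMatrix, dilation, Matrix.transpose_fromRows,
    Matrix.fromBlocks_mul_fromRows, Matrix.fromCols_mul_fromRows]
  simp only [Matrix.transpose_transpose, zero_mul, zero_add, add_zero, Matrix.neg_mul,
    Matrix.mul_neg, Matrix.trace_add, Matrix.trace_neg, transposed, firstVariation, Matrix.mul_add]
  rw [Matrix.trace_mul_comm (factorB v), Matrix.trace_mul_comm (factorB θ)]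
  simp only [Matrix.mul_assoc]
  ring

variable {S : Finset (Fin d × Fin d)} {M : Matrix (Fin d) (Fin d) ℝ}

theorem trace_residualMatrix_transpose_mul (θ : Param d) (Y : Matrix (Fin d) (Fin d) ℝ) :
    ((residualMatrix S M θ)ᵀ * Y).trace =
      ∑ p ∈ S, ((factorA θ * factorB θ) p.1 p.2 - M p.1 p.2) * Y p.1 p.2 := by
  simp only [Matrix.trace, Matrix.diag_apply, Matrix.mul_apply, Matrix.transpose_apply,
    residualMatrix, Matrix.of_apply, ite_mul, zero_mul]
  rw [← Fintype.sum_prod_type_right' (f := fun i j => if (i, j) ∈ S then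
    ((∑ l, factorA θ i l * factorB θ l j) - M i j) * Y i j else 0)]
  simp

theorem contDiff_risk {n : WithTop ℕ∞} : ContDiff ℝ n (risk S M) := by
  unfold risk factorA factorB
  simp only [Matrix.mul_apply, Matrix.of_apply]
  fun_prop

theorem risk_nonneg (θ : Param d) : 0 ≤ risk S M θ := by
  unfold risk
  positivity

theorem hasDerivAt_residual (θ v : Param d) (p : Fin d × Fin d) :
    HasDerivAt (fun s : ℝ => (factorA (θ + s • v) * factorB (θ + s • v)) p.1 p.2 - M p.1 p.2)
      (firstVariation θ v p.1 p.2) 0 :=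
  (hasDerivAt_factorA_mul_factorB θ v p.1 p.2).sub_const _

theorem inner_neg_gradient_risk (θ η : Param d) :
    inner ℝ η (-gradient (risk S M) θ) = -(2 / (S.card : ℝ) *
      ∑ p ∈ S, ((factorA θ * factorB θ) p.1 p.2 - M p.1 p.2) * firstVariation θ η p.1 p.2) := by
  have hdiff : DifferentiableAt ℝ (risk S M) θ :=
    (contDiff_risk (n := 1)).differentiable one_ne_zero θ
  have along_line : HasDerivAt (fun s : ℝ => risk S M (θ + s • η))
      (fderiv ℝ (risk S M) θ η) 0 := hdiff.hasFDerivAt.hasLineDerivAt η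
  have expanded := (HasDerivAt.fun_sum fun p (_ : p ∈ S) =>
    (hasDerivAt_residual (M := M) θ η p).pow 2).const_mul (1 / (S.card : ℝ))
  rw [inner_neg_right, real_inner_comm, inner_gradient_left, along_line.unique expanded]
  simp only [zero_smul, add_zero, Nat.cast_ofNat, Nat.add_one_sub_one, pow_one, mul_assoc,
    ← Finset.mul_sum]
  ring

theorem inner_neg_gradient_risk_eq_trace (θ η : Param d) :
    inner ℝ η (-gradient (risk S M) θ) = 2 / (S.card : ℝ) *
      ((augMatrix η)ᵀ * dilation (residualMatrix S M θ) * augMatrix θ).trace := by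
  rw [inner_neg_gradient_risk, trace_transpose_mul_dilation_mul, firstVariation_comm η,
    trace_residualMatrix_transpose_mul, mul_neg]

theorem augMatrix_neg_gradient_risk (θ : Param d) :
    augMatrix (-gradient (risk S M) θ) =
      (2 / (S.card : ℝ)) • (dilation (residualMatrix S M θ) * augMatrix θ) := by
  suffices h : -gradient (risk S M) θ =
      (augEquiv d).symm ((2 / (S.card : ℝ)) • (dilation (residualMatrix S M θ) * augMatrix θ)) by
    rw [h]
    exact (augEquiv d).apply_symm_apply _
  refine ext_inner_left ℝ fun η => ?_
  rw [inner_neg_gradient_risk_eq_trace, inner_eq_trace]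
  change _ = ((augMatrix η)ᵀ * (augEquiv d ((augEquiv d).symm _))).trace
  rw [LinearEquiv.apply_symm_apply, Matrix.mul_smul, Matrix.trace_smul, Matrix.mul_assoc,
    smul_eq_mul]

theorem inner_neg_hessian_risk (θ v η : Param d) :
    inner ℝ η ((-hessian (risk S M) θ) v) = 2 / (S.card : ℝ) *
      (((augMatrix η)ᵀ * dilation (residualMatrix S M θ) * augMatrix v).trace -
        ∑ p ∈ S, firstVariation θ v p.1 p.2 * firstVariation θ η p.1 p.2) := by
  have hdiff : DifferentiableAt ℝ (gradient (risk S M)) θ :=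
    (contDiff_gradient (n := 1) contDiff_risk).differentiable one_ne_zero θ
  have along_line : HasDerivAt (fun s : ℝ => gradient (risk S M) (θ + s • v))
      (hessian (risk S M) θ v) 0 := hdiff.hasFDerivAt.hasLineDerivAt v
  have hline := (hasDerivAt_const (0 : ℝ) η).inner ℝ along_line.neg
  have hvariation (p : Fin d × Fin d) : HasDerivAt
      (fun s : ℝ => firstVariation (θ + s • v) η p.1 p.2) (firstVariation v η p.1 p.2) 0 := by
    simp only [firstVariation_add_smul, Matrix.add_apply, Matrix.smul_apply, smul_eq_mul]
    simpa using ((hasDerivAt_id (0 : ℝ)).mul_const (firstVariation v η p.1 p.2)).const_add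
      (firstVariation θ η p.1 p.2)
  have expanded := ((HasDerivAt.fun_sum fun p (_ : p ∈ S) =>
    (hasDerivAt_residual (M := M) θ v p).fun_mul (hvariation p)).const_mul
      (2 / (S.card : ℝ))).fun_neg
  simp only [← inner_neg_gradient_risk] at expanded
  have hessian_eq := hline.unique expanded
  simp only [zero_smul, add_zero, inner_zero_left, Finset.sum_add_distrib,
    ← trace_residualMatrix_transpose_mul] at hessian_eq
  rw [_root_.neg_apply, hessian_eq, trace_transpose_mul_dilation_mul, firstVariation_comm η]
  ring

theorem isSymmetric_neg_hessian_risk (θ : Param d) :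
    ((-hessian (risk S M) θ : Param d →L[ℝ] Param d) : Param d →ₗ[ℝ] Param d).IsSymmetric := by
  intro v η
  rw [real_inner_comm]
  simp only [ContinuousLinearMap.coe_coe, inner_neg_hessian_risk,
    trace_transpose_mul_dilation_mul, firstVariation_comm v η,
    mul_comm (firstVariation θ v _ _)]

end Parameters

section TopEigenpair

variable {n : Type*} [Fintype n] [DecidableEq n] {N : Matrix n n ℝ} {σ : ℝ} {u : n → ℝ}

/-- `σ` is the largest eigenvalue of the symmetric matrix `N`, and its eigenspace is the line
spanned by `u`. That `σ` is the largest eigenvalue is expressed by `N ≤ σ • 1`. -/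
structure IsSimpleTopEigenpair (N : Matrix n n ℝ) (σ : ℝ) (u : n → ℝ) : Prop where
  posSemidef : (σ • 1 - N).PosSemidef
  ne_zero : u ≠ 0
  mulVec : N *ᵥ u = σ • u
  eq_smul : ∀ x, N *ᵥ x = σ • x → ∃ r : ℝ, x = r • u

theorem posSemidef_smul_one_sub (hN : N.IsHermitian)
    (hσ : σ ∈ upperBounds {μ : ℝ | Module.End.HasEigenvalue (Matrix.toLin' N) μ}) :
    (σ • (1 : Matrix n n ℝ) - N).PosSemidef := by
  have hH : (σ • (1 : Matrix n n ℝ) - N).IsHermitian :=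
    (Matrix.isHermitian_one.smul (IsSelfAdjoint.all σ)).sub hN
  refine hH.posSemidef_iff_eigenvalues_nonneg.2 fun i => ?_
  have heigen := hH.mulVec_eigenvectorBasis i
  set x : n → ℝ := ⇑(hH.eigenvectorBasis i) with hx
  have hx0 : x ≠ 0 := fun h0 => hH.eigenvectorBasis.orthonormal.ne_zero i
    (PiLp.ext fun j => congrFun h0 j)
  rw [Matrix.sub_mulVec, Matrix.smul_mulVec, Matrix.one_mulVec, sub_eq_iff_eq_add',
    ← sub_eq_iff_eq_add, ← sub_smul] at heigen
  have hle := hσ (Module.End.hasEigenvalue_of_hasEigenvector (f := Matrix.toLin' N) (x := x)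
    ⟨Module.End.mem_eigenspace_iff.2 heigen.symm, hx0⟩)
  rw [Pi.zero_apply]
  linarith

theorem exists_isSimpleTopEigenpair (hN : N.IsHermitian)
    (hσ : IsGreatest {μ : ℝ | Module.End.HasEigenvalue (Matrix.toLin' N) μ} σ)
    (hone : Module.finrank ℝ (Module.End.eigenspace (Matrix.toLin' N) σ) = 1) :
    ∃ u, IsSimpleTopEigenpair N σ u := by
  obtain ⟨u, hu⟩ := hσ.1.exists_hasEigenvector
  refine ⟨u, posSemidef_smul_one_sub hN hσ.2, hu.2, hu.apply_eq_smul, fun x hx => ?_⟩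
  obtain ⟨r, hr⟩ := (finrank_eq_one_iff_of_nonzero' (⟨u, hu.1⟩ :
    Module.End.eigenspace (Matrix.toLin' N) σ) (fun h => hu.2 (congrArg Subtype.val h))).1 hone
    ⟨x, Module.End.mem_eigenspace_iff.2 hx⟩
  exact ⟨r, (congrArg Subtype.val hr).symm⟩

theorem trace_transpose_mul_smul_one_sub_mul {m : Type*} [Fintype m]
    (V : Matrix n m ℝ) :
    (Vᵀ * (σ • 1 - N) * V).trace = σ * (Vᵀ * V).trace - (Vᵀ * N * V).trace := by
  rw [Matrix.mul_sub, Matrix.sub_mul, Matrix.trace_sub, Matrix.mul_smul, Matrix.mul_one,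
    Matrix.smul_mul, Matrix.trace_smul, smul_eq_mul]

namespace IsSimpleTopEigenpair

theorem pos [Nontrivial n] (h : IsSimpleTopEigenpair N σ u) (hN : N.trace = 0) : 0 < σ := by
  have trace_eq : (σ • 1 - N).trace = σ * Fintype.card n := by
    rw [Matrix.trace_sub, Matrix.trace_smul, Matrix.trace_one, hN, sub_zero, smul_eq_mul]
  have hcard : (0 : ℝ) < Fintype.card n := by exact_mod_cast Fintype.card_pos
  refine lt_of_le_of_ne
    (nonneg_of_mul_nonneg_left (trace_eq ▸ h.posSemidef.trace_nonneg) hcard) ?_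
  rintro rfl
  have hN0 : N = 0 := by
    rw [zero_mul, h.posSemidef.trace_eq_zero_iff, zero_smul, zero_sub, neg_eq_zero] at trace_eq
    exact trace_eq
  have finrank_le : Module.finrank ℝ (n → ℝ) ≤ 1 := by
    refine finrank_le_one u fun x => ?_
    obtain ⟨r, hr⟩ := h.eq_smul x (by rw [hN0, Matrix.zero_mulVec, zero_smul])
    exact ⟨r, hr.symm⟩
  rw [Module.finrank_fintype_fun_eq_card] at finrank_le
  exact absurd Fintype.one_lt_card finrank_le.not_gt

variable {m : Type*}

theorem posSemidef_transpose_mul_mul [Finite m] (h : IsSimpleTopEigenpair N σ u)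
    (V : Matrix n m ℝ) :
    (Vᵀ * (σ • 1 - N) * V).PosSemidef := by
  simpa using h.posSemidef.conjTranspose_mul_mul_same V

theorem trace_transpose_mul_mul_le [Fintype m] (h : IsSimpleTopEigenpair N σ u)
    (V : Matrix n m ℝ) :
    (Vᵀ * N * V).trace ≤ σ * (Vᵀ * V).trace :=
  sub_nonneg.1 <| trace_transpose_mul_smul_one_sub_mul (N := N) V ▸
    (h.posSemidef_transpose_mul_mul V).trace_nonneg

theorem exists_eq_vecMulVec [Fintype m] (h : IsSimpleTopEigenpair N σ u) {V : Matrix n m ℝ}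
    (hV : (Vᵀ * N * V).trace = σ * (Vᵀ * V).trace) : ∃ w, V = Matrix.vecMulVec u w := by
  have hzero : Vᵀ * (σ • 1 - N) * V = 0 := by
    rw [← (h.posSemidef_transpose_mul_mul V).trace_eq_zero_iff,
      trace_transpose_mul_smul_one_sub_mul, hV, sub_self]
  have hcol (l : m) : ∃ r : ℝ, V.col l = r • u := by
    refine h.eq_smul _ ?_
    have hquad : star (V.col l) ⬝ᵥ (σ • 1 - N) *ᵥ V.col l = 0 := by
      rw [star_trivial, Matrix.dotProduct_mulVec]
      exact congrFun (congrFun hzero l) l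
    rw [h.posSemidef.dotProduct_mulVec_zero_iff, Matrix.sub_mulVec, Matrix.smul_mulVec,
      Matrix.one_mulVec, sub_eq_zero] at hquad
    exact hquad.symm
  choose w hw using hcol
  refine ⟨w, ?_⟩
  ext i l
  rw [Matrix.vecMulVec_apply, mul_comm]
  exact congrFun (hw l) i

end IsSimpleTopEigenpair

end TopEigenpair

section TopSingularVector

variable {m n : Type*}

theorem isHermitian_dilation (X : Matrix m n ℝ) : (dilation X).IsHermitian := by
  rw [Matrix.IsHermitian, Matrix.conjTranspose_eq_transpose_of_trivial, dilation_transpose]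

theorem trace_dilation [Fintype m] [Fintype n] (X : Matrix m n ℝ) : (dilation X).trace = 0 := by
  simp [dilation, Matrix.trace]

variable [Fintype m] [Fintype n] {X : Matrix m n ℝ} {σ : ℝ} {u : m ⊕ n → ℝ}

theorem dilation_mulVec (X : Matrix m n ℝ) (u : m ⊕ n → ℝ) :
    dilation X *ᵥ u = Sum.elim (-(X *ᵥ (u ∘ Sum.inr))) (-(Xᵀ *ᵥ (u ∘ Sum.inl))) := by
  rw [dilation, Matrix.fromBlocks_mulVec]
  simp only [Matrix.zero_mulVec, Matrix.neg_mulVec, zero_add, add_zero]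

theorem comp_inl_ne_zero_of_dilation_mulVec (hσ : σ ≠ 0) (hu : u ≠ 0)
    (h : dilation X *ᵥ u = σ • u) : u ∘ Sum.inl ≠ 0 := by
  intro hl
  rw [dilation_mulVec, hl, Matrix.mulVec_zero] at h
  refine hu (funext (Sum.rec (congrFun hl) fun j => ?_))
  simpa [hσ] using (congrFun h (Sum.inr j)).symm

theorem comp_inr_ne_zero_of_dilation_mulVec (hσ : σ ≠ 0) (hu : u ≠ 0)
    (h : dilation X *ᵥ u = σ • u) : u ∘ Sum.inr ≠ 0 := by
  intro hr
  rw [dilation_mulVec, hr, Matrix.mulVec_zero] at h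
  refine hu (funext (Sum.rec (fun i => ?_) (congrFun hr)))
  simpa [hσ] using (congrFun h (Sum.inl i)).symm

theorem vecMul_eq_zero_of_dilation_mulVec {l : Type*} {V : Matrix (m ⊕ n) l ℝ} (hσ : σ ≠ 0)
    (hu : dilation X *ᵥ u = σ • u) (hV : dilation X * V = 0) : u ᵥ* V = 0 := by
  have scaled : σ • (u ᵥ* V) = 0 := by
    rw [← Matrix.smul_vecMul, ← hu, ← Matrix.vecMul_transpose, dilation_transpose,
      Matrix.vecMul_vecMul, hV, Matrix.vecMul_zero]
  exact (smul_eq_zero.1 scaled).resolve_left hσ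

theorem comp_inl_vecMul_toRows₁_eq_zero {l : Type*} {V : Matrix (m ⊕ n) l ℝ} (hσ : σ ≠ 0)
    (hu : dilation X *ᵥ u = σ • u) (hV : dilation X * V = 0) : (u ∘ Sum.inl) ᵥ* V.toRows₁ = 0 := by
  have hV₁ : Xᵀ * V.toRows₁ = 0 := by
    rw [← V.fromRows_toRows, dilation, Matrix.fromBlocks_mul_fromRows] at hV
    have lower : -(Xᵀ * V.toRows₁) = (0 : Matrix (m ⊕ n) l ℝ).toRows₂ := by
      simpa using congrArg Matrix.toRows₂ hV
    exact neg_eq_zero.1 lower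
  have hu₁ : σ • (u ∘ Sum.inl) = -(X *ᵥ (u ∘ Sum.inr)) := by
    rw [dilation_mulVec] at hu
    exact (congrArg (· ∘ Sum.inl) hu).symm
  have scaled : σ • ((u ∘ Sum.inl) ᵥ* V.toRows₁) = 0 := by
    rw [← Matrix.smul_vecMul, hu₁, Matrix.neg_vecMul, ← Matrix.vecMul_transpose,
      Matrix.vecMul_vecMul, hV₁, Matrix.vecMul_zero, neg_zero]
  exact (smul_eq_zero.1 scaled).resolve_left hσ

theorem comp_inr_vecMul_toRows₂_eq_zero {l : Type*} {V : Matrix (m ⊕ n) l ℝ} (hσ : σ ≠ 0)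
    (hu : dilation X *ᵥ u = σ • u) (hV : dilation X * V = 0) : (u ∘ Sum.inr) ᵥ* V.toRows₂ = 0 := by
  have hV₂ : X * V.toRows₂ = 0 := by
    rw [← V.fromRows_toRows, dilation, Matrix.fromBlocks_mul_fromRows] at hV
    have upper : -(X * V.toRows₂) = (0 : Matrix (m ⊕ n) l ℝ).toRows₁ := by
      simpa using congrArg Matrix.toRows₁ hV
    exact neg_eq_zero.1 upper
  have hu₂ : σ • (u ∘ Sum.inr) = -(Xᵀ *ᵥ (u ∘ Sum.inl)) := by
    rw [dilation_mulVec] at hu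
    exact (congrArg (· ∘ Sum.inr) hu).symm
  have scaled : σ • ((u ∘ Sum.inr) ᵥ* V.toRows₂) = 0 := by
    rw [← Matrix.smul_vecMul, hu₂, Matrix.neg_vecMul, Matrix.mulVec_transpose,
      Matrix.vecMul_vecMul, hV₂, Matrix.vecMul_zero, neg_zero]
  exact (smul_eq_zero.1 scaled).resolve_left hσ

theorem exists_isSimpleTopEigenpair_dilation {d : ℕ} {X : Matrix (Fin d) (Fin d) ℝ}
    (hX : UniqueTopSingularValue X) : ∃ σ > 0, ∃ u, IsSimpleTopEigenpair (dilation X) σ u := by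
  obtain ⟨σ, hσ, hone⟩ := hX
  obtain ⟨u, hu⟩ := exists_isSimpleTopEigenpair (isHermitian_dilation X) hσ hone
  obtain ⟨r, -⟩ := Function.ne_iff.1 hu.ne_zero
  have : Nontrivial (Fin d ⊕ Fin d) :=
    ⟨Sum.inl (r.elim id id), Sum.inr (r.elim id id), Sum.inl_ne_inr⟩
  exact ⟨σ, hu.pos (trace_dilation X), u, hu⟩

end TopSingularVector

section HessianSpectrum

variable {d : ℕ} {S : Finset (Fin d × Fin d)} {M : Matrix (Fin d) (Fin d) ℝ} {θ : Param d} {σ : ℝ}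
  {u : Fin d ⊕ Fin d → ℝ} {w : Fin d → ℝ}

/-- The parameter whose augmented matrix is the rank-one matrix `u ⊗ w`. -/
def rankOneParam (u : Fin d ⊕ Fin d → ℝ) (w : Fin d → ℝ) : Param d :=
  (augEquiv d).symm (Matrix.vecMulVec u w)

theorem augMatrix_rankOneParam (u : Fin d ⊕ Fin d → ℝ) (w : Fin d → ℝ) :
    augMatrix (rankOneParam u w) = Matrix.vecMulVec u w :=
  (augEquiv d).apply_symm_apply _

theorem rankOneParam_ne_zero (hu : u ≠ 0) (hw : w ≠ 0) : rankOneParam u w ≠ 0 := by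
  obtain ⟨r, hr⟩ := Function.ne_iff.1 hu
  obtain ⟨l, hl⟩ := Function.ne_iff.1 hw
  rw [Ne, rankOneParam, LinearEquiv.map_eq_zero_iff]
  exact fun h => mul_ne_zero hr hl (congrFun (congrFun h r) l)

theorem firstVariation_rankOneParam (θ : Param d) (u : Fin d ⊕ Fin d → ℝ) (w : Fin d → ℝ) :
    firstVariation θ (rankOneParam u w) =
      Matrix.vecMulVec (u ∘ Sum.inl) ((augMatrix θ *ᵥ w) ∘ Sum.inr) +
        Matrix.vecMulVec ((augMatrix θ *ᵥ w) ∘ Sum.inl) (u ∘ Sum.inr) := by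
  have hA : factorA (rankOneParam u w) = Matrix.vecMulVec (u ∘ Sum.inl) w := rfl
  have hB : factorB (rankOneParam u w) = Matrix.vecMulVec w (u ∘ Sum.inr) := by
    ext l j
    exact mul_comm _ _
  rw [firstVariation, hA, hB, Matrix.vecMulVec_mul, Matrix.mul_vecMulVec, augMatrix,
    Matrix.fromRows_mulVec, Sum.elim_comp_inl, Sum.elim_comp_inr, Matrix.mulVec_transpose]

theorem neg_hessian_risk_rankOneParam (hu : dilation (residualMatrix S M θ) *ᵥ u = σ • u)
    (hw : augMatrix θ *ᵥ w = 0) :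
    (-hessian (risk S M) θ) (rankOneParam u w) =
      (2 / (S.card : ℝ) * σ) • rankOneParam u w := by
  have stationary : firstVariation θ (rankOneParam u w) = 0 := by
    rw [firstVariation_rankOneParam, hw]
    ext i j
    simp
  refine ext_inner_left ℝ fun η => ?_
  rw [inner_neg_hessian_risk, stationary, inner_smul_right, inner_eq_trace, Matrix.mul_assoc,
    augMatrix_rankOneParam, Matrix.mul_vecMulVec, hu, Matrix.smul_vecMulVec, Matrix.mul_smul,
    Matrix.trace_smul, smul_eq_mul]
  simp [mul_assoc]

theorem inner_neg_hessian_risk_self_le (v : Param d) :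
    inner ℝ v ((-hessian (risk S M) θ) v) ≤ 2 / (S.card : ℝ) *
      ((augMatrix v)ᵀ * dilation (residualMatrix S M θ) * augMatrix v).trace := by
  rw [inner_neg_hessian_risk]
  gcongr
  exact sub_le_self _ (Finset.sum_nonneg fun p _ => mul_self_nonneg _)

theorem le_of_neg_hessian_risk_eq_smul
    (hu : IsSimpleTopEigenpair (dilation (residualMatrix S M θ)) σ u) {lam : ℝ} {v : Param d}
    (hv : (-hessian (risk S M) θ) v = lam • v) (hv0 : v ≠ 0) : lam ≤ 2 / (S.card : ℝ) * σ := by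
  have quadratic : lam * inner ℝ v v ≤ 2 / (S.card : ℝ) * σ * inner ℝ v v := by
    rw [← real_inner_smul_right, ← hv, mul_assoc, inner_eq_trace v v]
    exact (inner_neg_hessian_risk_self_le v).trans
      (mul_le_mul_of_nonneg_left (hu.trace_transpose_mul_mul_le _) (by positivity))
  exact le_of_mul_le_mul_right quadratic (real_inner_self_pos.2 hv0)

theorem exists_eq_rankOneParam (hS : S.Nonempty)
    (hu : IsSimpleTopEigenpair (dilation (residualMatrix S M θ)) σ u) {v : Param d}
    (hv : (-hessian (risk S M) θ) v = (2 / (S.card : ℝ) * σ) • v) : ∃ w, v = rankOneParam u w := by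
  have hcard : (0 : ℝ) < 2 / S.card := div_pos two_pos (by exact_mod_cast hS.card_pos)
  have attained := inner_neg_hessian_risk_self_le (S := S) (M := M) (θ := θ) v
  rw [hv, real_inner_smul_right, mul_assoc, mul_le_mul_iff_right₀ hcard, inner_eq_trace] at attained
  obtain ⟨w, hw⟩ := hu.exists_eq_vecMulVec ((hu.trace_transpose_mul_mul_le _).antisymm attained)
  refine ⟨w, (augEquiv d).injective ?_⟩
  exact hw.trans (augMatrix_rankOneParam u w).symm

theorem nonempty_of_dilation_residualMatrix_ne_zero
    (h : dilation (residualMatrix S M θ) ≠ 0) : S.Nonempty := by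
  rw [Finset.nonempty_iff_ne_empty]
  rintro rfl
  refine h ?_
  ext (i | i) (j | j) <;> simp [dilation, residualMatrix]

theorem nonempty_of_dilation_residualMatrix_mulVec (hσ : σ ≠ 0) (hu : u ≠ 0)
    (h : dilation (residualMatrix S M θ) *ᵥ u = σ • u) : S.Nonempty := by
  refine nonempty_of_dilation_residualMatrix_ne_zero (M := M) (θ := θ) fun h0 => ?_
  rw [h0, Matrix.zero_mulVec] at h
  exact smul_ne_zero hσ hu h.symm

theorem dilation_residualMatrix_mul_augMatrix (hS : S.Nonempty)
    (hcrit : gradient (risk S M) θ = 0) :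
    dilation (residualMatrix S M θ) * augMatrix θ = 0 := by
  have hcard : (2 / (S.card : ℝ)) ≠ 0 := by simpa using hS.ne_empty
  have hgrad := augMatrix_neg_gradient_risk (S := S) (M := M) θ
  rw [hcrit, neg_zero, augMatrix_zero] at hgrad
  exact (smul_eq_zero.1 hgrad.symm).resolve_left hcard

theorem topEigenvalue_neg_hessian_risk
    (hu : IsSimpleTopEigenpair (dilation (residualMatrix S M θ)) σ u)
    (hw : augMatrix θ *ᵥ w = 0) (hw0 : w ≠ 0) {lam : ℝ}
    (hlam : IsTopEigenvalue (-hessian (risk S M) θ) lam) : lam = 2 / (S.card : ℝ) * σ := by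
  obtain ⟨v, hv⟩ := hlam.1.exists_hasEigenvector
  refine le_antisymm (le_of_neg_hessian_risk_eq_smul hu hv.apply_eq_smul hv.2) ?_
  exact hlam.2 (Module.End.hasEigenvalue_of_hasEigenvector (x := rankOneParam u w)
    ⟨Module.End.mem_eigenspace_iff.2 (neg_hessian_risk_rankOneParam hu.mulVec hw),
      rankOneParam_ne_zero hu.ne_zero hw0⟩)

theorem topEigenvalue_neg_hessian_risk_pos (hσ : 0 < σ)
    (hu : IsSimpleTopEigenpair (dilation (residualMatrix S M θ)) σ u)
    (hw : augMatrix θ *ᵥ w = 0) (hw0 : w ≠ 0) {lam : ℝ}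
    (hlam : IsTopEigenvalue (-hessian (risk S M) θ) lam) : 0 < lam := by
  have hS := nonempty_of_dilation_residualMatrix_mulVec hσ.ne' hu.ne_zero hu.mulVec
  rw [topEigenvalue_neg_hessian_risk hu hw hw0 hlam]
  exact mul_pos (div_pos two_pos (by exact_mod_cast hS.card_pos)) hσ

end HessianSpectrum

section Rank

variable {m n : Type*}

theorem vecMul_mem_span_row [Fintype m] (u : m → ℝ) (X : Matrix m n ℝ) :
    u ᵥ* X ∈ Submodule.span ℝ (Set.range X.row) := by
  rw [Matrix.vecMul_eq_sum]
  exact Submodule.sum_mem _ fun i _ => Submodule.smul_mem _ _ (Submodule.subset_span ⟨i, rfl⟩)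

theorem le_rank_of_injOn [Fintype n] {X : Matrix m n ℝ} {k : ℕ} {α : Fin k → n → ℝ}
    (hα : LinearIndependent ℝ α)
    (h : ∀ x ∈ Submodule.span ℝ (Set.range α), X *ᵥ x = 0 → x = 0) : k ≤ X.rank := by
  have himage : LinearIndependent ℝ (X.mulVecLin ∘ α) :=
    hα.map (LinearMap.disjoint_ker.2 h)
  rw [Matrix.rank, ← Fintype.card_fin k, ← finrank_span_eq_card himage]
  refine Submodule.finrank_mono (Submodule.span_le.2 ?_)
  rintro _ ⟨i, rfl⟩
  exact ⟨α i, rfl⟩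

theorem exists_notMem_mulVec_eq_zero [Fintype n] {X : Matrix m n ℝ}
    {U : Submodule ℝ (n → ℝ)} (hU : U < ⊤) (hX : ∀ i, X i ∈ U) : ∃ w ∉ U, X *ᵥ w = 0 := by
  classical
  obtain ⟨f, hf, hker⟩ := Submodule.exists_le_ker_of_lt_top U hU
  obtain ⟨w, rfl⟩ := (dotProductEquiv ℝ n).surjective f
  have orthogonal (x) (hx : x ∈ U) : w ⬝ᵥ x = 0 := hker hx
  refine ⟨w, fun hw => hf ?_, funext fun i => (dotProduct_comm _ _).trans (orthogonal _ (hX i))⟩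
  rw [dotProduct_self_eq_zero.1 (orthogonal w hw), map_zero]

variable [Fintype n]

theorem rank_le_finrank [Finite m] {X : Matrix m n ℝ} {U : Submodule ℝ (n → ℝ)} (h : ∀ i, X i ∈ U) :
    X.rank ≤ Module.finrank ℝ U := by
  rw [X.rank_eq_finrank_span_row]
  exact Submodule.finrank_mono (Submodule.span_le.2 (Set.range_subset_iff.2 h))

theorem le_rank_of_linearIndependent [Finite m] {X : Matrix m n ℝ} {k : ℕ} {f : Fin k → n → ℝ}
    (hf : LinearIndependent ℝ f) (hmem : ∀ i, f i ∈ Submodule.span ℝ (Set.range X.row)) :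
    k ≤ X.rank := by
  rw [X.rank_eq_finrank_span_row, ← Fintype.card_fin k, ← finrank_span_eq_card hf]
  exact Submodule.finrank_mono (Submodule.span_le.2 (Set.range_subset_iff.2 hmem))

theorem rank_le_finrank_add_one [Finite m] {X : Matrix m n ℝ} {U : Submodule ℝ (n → ℝ)} {w : n → ℝ}
    (h : ∀ i, X i ∈ U ⊔ Submodule.span ℝ {w}) : X.rank ≤ Module.finrank ℝ U + 1 := by
  refine (rank_le_finrank h).trans ((Submodule.finrank_add_le_finrank_add_finrank _ _).trans ?_)
  gcongr
  exact (finrank_span_le_card {w}).trans (by simp)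

theorem exists_linearIndependent_rows [Finite m] (X : Matrix m n ℝ) :
    ∃ i : Fin X.rank → m, LinearIndependent ℝ (fun r => X (i r)) ∧
      Submodule.span ℝ (Set.range fun r => X (i r)) = Submodule.span ℝ (Set.range X.row) := by
  obtain ⟨f, hf, hspan, hli⟩ : ∃ f : Fin X.rank → n → ℝ, (∀ r, f r ∈ Set.range X.row) ∧
      Submodule.span ℝ (Set.range f) = Submodule.span ℝ (Set.range X.row) ∧
      LinearIndependent ℝ f := by
    rw [X.rank_eq_finrank_span_row]
    exact Submodule.exists_fun_fin_finrank_span_eq ℝ (Set.range X.row)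
  choose i hi using hf
  obtain rfl : (fun r => X (i r)) = f := funext hi
  exact ⟨i, hli, hspan⟩

/- Since `u` annihilates the columns of `X`, the rescaled vectors `ε t • u ᵥ* Y t` of the row space
of `Y t` tend to a multiple of `w`, so that together with `X.rank` rows of `Y t` they are eventually
linearly independent. -/
theorem eventually_rank_add_one_le [Fintype m] {ι : Type*} {l : Filter ι} {X : Matrix m n ℝ}
    {Y : ι → Matrix m n ℝ} {ε : ι → ℝ} {u : m → ℝ} {w : n → ℝ} (hY : Tendsto Y l (𝓝 X))
    (h : Tendsto (fun t => ε t • (Y t - X)) l (𝓝 (Matrix.vecMulVec u w))) (hu : u ᵥ* X = 0)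
    (hu0 : u ≠ 0) (hw : w ∉ Submodule.span ℝ (Set.range X.row)) :
    ∀ᶠ t in l, X.rank + 1 ≤ (Y t).rank := by
  obtain ⟨i, hli, hspan⟩ := exists_linearIndependent_rows X
  have huu : u ⬝ᵥ u ≠ 0 := fun h0 => hu0 (dotProduct_self_eq_zero.1 h0)
  have hlead : Tendsto (fun t => ε t • (u ᵥ* Y t)) l (𝓝 ((u ⬝ᵥ u) • w)) := by
    have hcont : Continuous fun Z : Matrix m n ℝ => u ᵥ* Z :=
      continuous_const.matrix_vecMul continuous_id
    have hcomp := (hcont.tendsto _).comp h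
    rw [Matrix.vecMul_vecMulVec] at hcomp
    refine hcomp.congr fun t => ?_
    rw [Function.comp_apply, Matrix.vecMul_smul, Matrix.vecMul_sub, hu, sub_zero]
  have hlim : Tendsto (fun t => (Fin.cons (ε t • (u ᵥ* Y t)) fun r => Y t (i r) :
      Fin (X.rank + 1) → n → ℝ)) l (𝓝 (Fin.cons ((u ⬝ᵥ u) • w) fun r => X (i r))) :=
    hlead.finCons (tendsto_pi_nhds.2 fun r => tendsto_pi_nhds.1 hY (i r))
  have hlim_li : LinearIndependent ℝ
      (Fin.cons ((u ⬝ᵥ u) • w) fun r => X (i r) : Fin (X.rank + 1) → n → ℝ) := by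
    rw [linearIndependent_finCons, hspan, Submodule.smul_mem_iff _ huu]
    exact ⟨hli, hw⟩
  filter_upwards [hlim.eventually hlim_li.eventually] with t ht
  refine le_rank_of_linearIndependent ht (Fin.cases ?_ fun r => Submodule.subset_span ⟨i r, rfl⟩)
  exact Submodule.smul_mem _ _ (vecMul_mem_span_row u (Y t))

end Rank

section Invariance

theorem augMatrix_add_row {d : ℕ} (θ η : Param d) (r : Fin d ⊕ Fin d) :
    augMatrix (θ + η) r = augMatrix θ r + augMatrix η r :=
  congrFun (augMatrix_add θ η) r

theorem augMatrix_smul_row {d : ℕ} (a : ℝ) (θ : Param d) (r : Fin d ⊕ Fin d) :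
    augMatrix (a • θ) r = a • augMatrix θ r :=
  congrFun (augMatrix_smul a θ) r

theorem mul_row_mem {l m n : Type*} [Fintype m] {N : Matrix l m ℝ} {X : Matrix m n ℝ}
    {U : Submodule ℝ (n → ℝ)} {r : l} (h : ∀ s, N r s ≠ 0 → X s ∈ U) : (N * X) r ∈ U := by
  rw [Matrix.mul_apply_eq_vecMul, Matrix.vecMul_eq_sum]
  refine U.sum_mem fun s _ => ?_
  by_cases hs : N r s = 0
  · rw [hs, zero_smul]
    exact U.zero_mem
  · exact U.smul_mem _ (h s hs)

theorem dilation_apply_self {n : Type*} (X : Matrix n n ℝ) (r : n ⊕ n) : dilation X r r = 0 := by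
  rcases r with i | i <;> rfl

theorem dilation_apply_eq_zero {m n : Type*} {X : Matrix m n ℝ} {R : Set (m ⊕ n)}
    (hX : ∀ i j, Sum.inl i ∈ R → Sum.inr j ∈ R → X i j = 0) {r s : m ⊕ n} (hr : r ∈ R)
    (hs : s ∈ R) : dilation X r s = 0 := by
  rcases r with i | j <;> rcases s with i' | j'
  · rfl
  · exact neg_eq_zero.2 (hX i j' hr hs)
  · exact neg_eq_zero.2 (hX i' j hs hr)
  · rfl

variable {d k : ℕ} {S : Finset (Fin d × Fin d)} {M : Matrix (Fin d) (Fin d) ℝ} {θ v : Param d}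
  {R : Set (Fin d ⊕ Fin d)} {U : Submodule ℝ (Fin d → ℝ)}

/-- The parameters whose augmented matrix has its rows in `U` and vanishes outside the rows in `R`.
-/
def blockSubmodule (R : Set (Fin d ⊕ Fin d)) (U : Submodule ℝ (Fin d → ℝ)) :
    Submodule ℝ (Param d) where
  carrier := {θ | (∀ r, augMatrix θ r ∈ U) ∧ ∀ r ∉ R, augMatrix θ r = 0}
  add_mem' := by
    rintro θ η ⟨hU, hR⟩ ⟨hU', hR'⟩
    refine ⟨fun r => augMatrix_add_row θ η r ▸ U.add_mem (hU r) (hU' r), fun r hr => ?_⟩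
    rw [augMatrix_add_row, hR r hr, hR' r hr, add_zero]
  zero_mem' := by
    rw [Set.mem_ofPred_eq, augMatrix_zero]
    exact ⟨fun _ => U.zero_mem, fun _ _ => rfl⟩
  smul_mem' := by
    rintro a θ ⟨hU, hR⟩
    refine ⟨fun r => augMatrix_smul_row a θ r ▸ U.smul_mem a (hU r), fun r hr => ?_⟩
    rw [augMatrix_smul_row, hR r hr, smul_zero]

theorem mem_blockSubmodule :
    θ ∈ blockSubmodule R U ↔ (∀ r, augMatrix θ r ∈ U) ∧ ∀ r ∉ R, augMatrix θ r = 0 :=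
  Iff.rfl

theorem mem_blockSubmodule_univ :
    θ ∈ blockSubmodule Set.univ U ↔ ∀ r, augMatrix θ r ∈ U := by
  simp [mem_blockSubmodule]

theorem coe_blockSubmodule_univ_span (α : Fin k → Fin d → ℝ) :
    (blockSubmodule Set.univ (Submodule.span ℝ (Set.range α)) : Set (Param d)) = Omega α := by
  ext θ
  exact mem_blockSubmodule_univ.trans Sum.forall

theorem rankOneParam_mem_blockSubmodule {u : Fin d ⊕ Fin d → ℝ} {w : Fin d → ℝ}
    (hu : ∀ r ∉ R, u r = 0) (hw : w ∈ U) : rankOneParam u w ∈ blockSubmodule R U := by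
  rw [mem_blockSubmodule, augMatrix_rankOneParam]
  refine ⟨fun r => U.smul_mem (u r) hw, fun r hr => ?_⟩
  ext l
  rw [Matrix.vecMulVec_apply, hu r hr, zero_mul, Pi.zero_apply]

theorem mem_of_rankOneParam_mem_blockSubmodule {u : Fin d ⊕ Fin d → ℝ} {w : Fin d → ℝ}
    (hu : u ≠ 0) (h : rankOneParam u w ∈ blockSubmodule R U) : w ∈ U := by
  obtain ⟨r, hr⟩ := Function.ne_iff.1 hu
  rw [mem_blockSubmodule, augMatrix_rankOneParam] at h
  exact (Submodule.smul_mem_iff U hr).1 (h.1 r)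

/-- `R` is a union of connected components of the bipartite graph of the observed positions. -/
def IsBlock (S : Finset (Fin d × Fin d)) (R : Set (Fin d ⊕ Fin d)) : Prop :=
  ∀ ⦃r s⦄, (bipartiteGraph S).Adj r s → (r ∈ R ↔ s ∈ R)

theorem isBlock_univ (S : Finset (Fin d × Fin d)) : IsBlock S Set.univ :=
  fun _ _ _ => Iff.rfl

theorem isBlock_component (L : (observationGraph S).ConnectedComponent) :
    IsBlock S {r | ∃ h : r ∈ (bipartiteGraph S).support,
      (observationGraph S).connectedComponentMk ⟨r, h⟩ = L} := by
  intro r s hadj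
  have hr : r ∈ (bipartiteGraph S).support := ⟨s, hadj⟩
  have hs : s ∈ (bipartiteGraph S).support := ⟨r, hadj.symm⟩
  have same_component : (observationGraph S).connectedComponentMk ⟨r, hr⟩ =
      (observationGraph S).connectedComponentMk ⟨s, hs⟩ :=
    SimpleGraph.ConnectedComponent.connectedComponentMk_eq_of_adj hadj
  exact ⟨fun ⟨_, h⟩ => ⟨hs, same_component ▸ h⟩, fun ⟨_, h⟩ => ⟨hr, same_component.trans h⟩⟩

theorem IsRankInvariantManifold.exists_eq_blockSubmodule {Ω : Set (Param d)}
    (hΩ : IsRankInvariantManifold S k Ω) :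
    ∃ (α : Fin k → Fin d → ℝ) (R : Set (Fin d ⊕ Fin d)), LinearIndependent ℝ α ∧ IsBlock S R ∧
      Ω = blockSubmodule R (Submodule.span ℝ (Set.range α)) := by
  obtain ⟨α, hα, rfl | ⟨L, rfl⟩⟩ := hΩ
  · exact ⟨α, Set.univ, hα, isBlock_univ S, (coe_blockSubmodule_univ_span α).symm⟩
  · refine ⟨α, _, hα, isBlock_component L, ?_⟩
    ext θ
    rw [SetLike.mem_coe, mem_blockSubmodule, Sum.forall, Sum.forall]
    rfl

theorem augMatrix_neg_gradient_risk_row (θ : Param d) (r : Fin d ⊕ Fin d) :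
    augMatrix (-gradient (risk S M) θ) r =
      (2 / (S.card : ℝ)) • (dilation (residualMatrix S M θ) * augMatrix θ) r :=
  congrFun (augMatrix_neg_gradient_risk θ) r

theorem adj_of_dilation_residualMatrix_ne_zero {r s : Fin d ⊕ Fin d}
    (h : dilation (residualMatrix S M θ) r s ≠ 0) : (bipartiteGraph S).Adj r s := by
  have observed_of_ne_zero {i j} (hij : residualMatrix S M θ i j ≠ 0) : (i, j) ∈ S := by
    by_contra hS
    exact hij (if_neg hS)
  rw [bipartiteGraph, SimpleGraph.fromRel_adj]
  rcases r with i | j <;> rcases s with i' | j'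
  · exact absurd rfl h
  · exact ⟨Sum.inl_ne_inr, Or.inl ⟨i, j', observed_of_ne_zero (neg_ne_zero.1 h), rfl, rfl⟩⟩
  · exact ⟨Sum.inr_ne_inl, Or.inr ⟨i', j, observed_of_ne_zero (neg_ne_zero.1 h), rfl, rfl⟩⟩
  · exact absurd rfl h

theorem neg_gradient_risk_mem_blockSubmodule (hR : IsBlock S R) (hθ : θ ∈ blockSubmodule R U) :
    -gradient (risk S M) θ ∈ blockSubmodule R U := by
  simp only [mem_blockSubmodule, augMatrix_neg_gradient_risk_row]
  refine ⟨fun r => U.smul_mem _ (mul_row_mem fun s _ => hθ.1 s), fun r hr => ?_⟩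
  have row_eq_zero : (dilation (residualMatrix S M θ) * augMatrix θ) r = 0 :=
    (Submodule.mem_bot ℝ).1 <| mul_row_mem fun s hs => (Submodule.mem_bot ℝ).2 <|
      hθ.2 s fun hsR => hr ((hR (adj_of_dilation_residualMatrix_ne_zero hs)).2 hsR)
  rw [row_eq_zero, smul_zero]

theorem residualMatrix_congr {η : Param d} {i j : Fin d}
    (hi : augMatrix θ (Sum.inl i) = augMatrix η (Sum.inl i))
    (hj : augMatrix θ (Sum.inr j) = augMatrix η (Sum.inr j)) :
    residualMatrix S M θ i j = residualMatrix S M η i j := by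
  have product_eq : (factorA θ * factorB θ) i j = (factorA η * factorB η) i j :=
    congrArg₂ dotProduct hi hj
  simp only [residualMatrix, Matrix.of_apply, product_eq]

theorem notMem_of_dilation_residualMatrix_add_ne_zero (hR : IsBlock S R)
    (hres : ∀ i j, Sum.inl i ∈ R → Sum.inr j ∈ R → residualMatrix S M θ i j = 0)
    (hv : v ∈ blockSubmodule Rᶜ U) {r s : Fin d ⊕ Fin d}
    (h : dilation (residualMatrix S M (θ + v)) r s ≠ 0) : r ∉ R ∧ s ∉ R := by
  have unchanged {r} (hr : r ∈ R) : augMatrix (θ + v) r = augMatrix θ r := by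
    rw [augMatrix_add_row, hv.2 r (not_not_intro hr), add_zero]
  have hrs := hR (adj_of_dilation_residualMatrix_ne_zero h)
  have hr : r ∉ R := fun hr => h <| dilation_apply_eq_zero
    (fun i j hi hj => (residualMatrix_congr (unchanged hi) (unchanged hj)).trans (hres i j hi hj))
    hr (hrs.1 hr)
  exact ⟨hr, hrs.not.1 hr⟩

/- When the residual vanishes on the block `R`, increments outside `R` do not feel the rows of `θ`,
all of which are in `R`. -/
theorem neg_gradient_risk_add_mem_blockSubmodule_compl (hR : IsBlock S R)
    (hres : ∀ i j, Sum.inl i ∈ R → Sum.inr j ∈ R → residualMatrix S M θ i j = 0)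
    (hθ : ∀ r ∉ R, augMatrix θ r = 0) (hv : v ∈ blockSubmodule Rᶜ U) :
    -gradient (risk S M) (θ + v) ∈ blockSubmodule Rᶜ U := by
  simp only [mem_blockSubmodule, augMatrix_neg_gradient_risk_row]
  refine ⟨fun r => U.smul_mem _ (mul_row_mem fun s hs => ?_), fun r hr => ?_⟩
  · have hsR := (notMem_of_dilation_residualMatrix_add_ne_zero hR hres hv hs).2
    rw [augMatrix_add_row, hθ s hsR, zero_add]
    exact hv.1 s
  · have row_eq_zero : (dilation (residualMatrix S M (θ + v)) * augMatrix (θ + v)) r = 0 :=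
      (Submodule.mem_bot ℝ).1 <| mul_row_mem fun s hs =>
        absurd (notMem_of_dilation_residualMatrix_add_ne_zero hR hres hv hs).1 hr
    rw [row_eq_zero, smul_zero]

theorem eq_zero_of_dilation_residualMatrix_mulVec (hR : IsBlock S R)
    (hres : ∀ i j, Sum.inl i ∈ R → Sum.inr j ∈ R → residualMatrix S M θ i j = 0) {σ : ℝ}
    (hσ : σ ≠ 0) {u : Fin d ⊕ Fin d → ℝ} (hu : dilation (residualMatrix S M θ) *ᵥ u = σ • u)
    {r : Fin d ⊕ Fin d} (hr : r ∈ R) : u r = 0 := by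
  have row_eq_zero : (dilation (residualMatrix S M θ) *ᵥ u) r = 0 := by
    rw [Matrix.mulVec, dotProduct]
    refine Finset.sum_eq_zero fun s _ => mul_eq_zero_of_left ?_ _
    by_contra hs
    have adj := adj_of_dilation_residualMatrix_ne_zero hs
    exact hs (dilation_apply_eq_zero hres hr ((hR adj).1 hr))
  rw [hu, Pi.smul_apply, smul_eq_mul] at row_eq_zero
  exact (mul_eq_zero.1 row_eq_zero).resolve_left hσ

end Invariance

section SecondOrder

theorem inner_map_eq_zero_of_nonneg {E : Type*} [NormedAddCommGroup E] [InnerProductSpace ℝ E]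
    {T : E →ₗ[ℝ] E} (hT : T.IsSymmetric) {V : Submodule ℝ E} (hV : ∀ v ∈ V, 0 ≤ inner ℝ v (T v))
    {x y : E} (hx : x ∈ V) (hy : y ∈ V) (h : inner ℝ x (T x) = 0) : inner ℝ y (T x) = 0 := by
  have cauchy_schwarz : inner ℝ x (T y) * inner ℝ y (T x) ≤ inner ℝ x (T x) * inner ℝ y (T y) :=
    ((LinearMap.BilinForm.compRight (innerₗ E) T).restrict V).apply_mul_apply_le_of_forall_zero_le
      (fun v => hV v v.2) ⟨x, hx⟩ ⟨y, hy⟩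
  rw [h, zero_mul, ← hT x y, real_inner_comm] at cauchy_schwarz
  exact mul_self_eq_zero.1 (cauchy_schwarz.antisymm (mul_self_nonneg _))

variable {d k : ℕ} {S : Finset (Fin d × Fin d)} {M : Matrix (Fin d) (Fin d) ℝ} {θ : Param d}
  {R : Set (Fin d ⊕ Fin d)} {U : Submodule ℝ (Fin d → ℝ)}

theorem inner_rankOneParam_neg_hessian_risk {u : Fin d ⊕ Fin d → ℝ} {x : Fin d → ℝ}
    (h : firstVariation θ (rankOneParam u x) = 0) (u' : Fin d ⊕ Fin d → ℝ) :
    inner ℝ (rankOneParam u' x) ((-hessian (risk S M) θ) (rankOneParam u x)) =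
      2 / (S.card : ℝ) * ((u' ⬝ᵥ dilation (residualMatrix S M θ) *ᵥ u) * (x ⬝ᵥ x)) := by
  rw [inner_neg_hessian_risk, h, augMatrix_rankOneParam, augMatrix_rankOneParam,
    Matrix.transpose_vecMulVec, Matrix.mul_assoc, Matrix.mul_vecMulVec,
    Matrix.vecMulVec_mul_vecMulVec, Matrix.trace_vecMulVec]
  simp

theorem eq_zero_of_firstVariation_eq_zero
    (hsos : ∀ v ∈ blockSubmodule R U, 0 ≤ inner ℝ v (hessian (risk S M) θ v))
    {r s : Fin d ⊕ Fin d} (hr : r ∈ R) (hs : s ∈ R)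
    (hrs : dilation (residualMatrix S M θ) r s ≠ 0) {x : Fin d → ℝ} (hx : x ∈ U)
    (h : firstVariation θ (rankOneParam (Pi.single s 1) x) = 0) : x = 0 := by
  have hcard : (S.card : ℝ) ≠ 0 := by
    have hS : S.Nonempty := nonempty_of_dilation_residualMatrix_ne_zero (M := M) (θ := θ)
      fun h0 => hrs (congrFun (congrFun h0 r) s)
    exact_mod_cast hS.card_ne_zero
  have hsymm : (hessian (risk S M) θ : Param d →ₗ[ℝ] Param d).IsSymmetric := fun v η => by
    simpa using isSymmetric_neg_hessian_risk (S := S) (M := M) θ v η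
  have mem {t} (ht : t ∈ R) : rankOneParam (Pi.single t 1) x ∈ blockSubmodule R U :=
    rankOneParam_mem_blockSubmodule
      (fun t' ht' => Pi.single_eq_of_ne (ne_of_mem_of_not_mem ht ht').symm 1) hx
  have entry (t) : inner ℝ (rankOneParam (Pi.single t 1) x)
      (hessian (risk S M) θ (rankOneParam (Pi.single s 1) x)) =
        -(2 / (S.card : ℝ) * (dilation (residualMatrix S M θ) t s * (x ⬝ᵥ x))) := by
    have hinner := inner_rankOneParam_neg_hessian_risk (S := S) (M := M) h (Pi.single t 1)
    rw [_root_.neg_apply, inner_neg_right, neg_eq_iff_eq_neg] at hinner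
    simpa using hinner
  have offdiagonal := inner_map_eq_zero_of_nonneg hsymm hsos (mem hs) (mem hr)
    ((entry s).trans (by simp [dilation_apply_self]))
  rw [ContinuousLinearMap.coe_coe, entry r] at offdiagonal
  simpa [hcard, hrs] using offdiagonal

theorem le_rank_factorA {α : Fin k → Fin d → ℝ} (hα : LinearIndependent ℝ α)
    (hsos : ∀ v ∈ blockSubmodule R (Submodule.span ℝ (Set.range α)),
      0 ≤ inner ℝ v (hessian (risk S M) θ v)) {i j : Fin d} (hi : Sum.inl i ∈ R)
    (hj : Sum.inr j ∈ R) (hij : residualMatrix S M θ i j ≠ 0) : k ≤ (factorA θ).rank := by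
  refine le_rank_of_injOn hα fun x hx hAx =>
    eq_zero_of_firstVariation_eq_zero hsos hi hj (neg_ne_zero.2 hij) hx ?_
  have image_eq_zero : (augMatrix θ *ᵥ x) ∘ Sum.inl = 0 := by
    rw [augMatrix, Matrix.fromRows_mulVec, Sum.elim_comp_inl, hAx]
  rw [firstVariation_rankOneParam, image_eq_zero]
  ext a b
  simp [Matrix.vecMulVec_apply]

theorem le_rank_transpose_factorB {α : Fin k → Fin d → ℝ} (hα : LinearIndependent ℝ α)
    (hsos : ∀ v ∈ blockSubmodule R (Submodule.span ℝ (Set.range α)),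
      0 ≤ inner ℝ v (hessian (risk S M) θ v)) {i j : Fin d} (hi : Sum.inl i ∈ R)
    (hj : Sum.inr j ∈ R) (hij : residualMatrix S M θ i j ≠ 0) : k ≤ (factorB θ)ᵀ.rank := by
  refine le_rank_of_injOn hα fun x hx hBx =>
    eq_zero_of_firstVariation_eq_zero hsos hj hi (neg_ne_zero.2 hij) hx ?_
  have image_eq_zero : (augMatrix θ *ᵥ x) ∘ Sum.inr = 0 := by
    rw [augMatrix, Matrix.fromRows_mulVec, Sum.elim_comp_inr, hBx]
  rw [firstVariation_rankOneParam, image_eq_zero]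
  ext a b
  simp [Matrix.vecMulVec_apply]

end SecondOrder

section SaddleEscape

theorem ae_starProjection_notMem {E : Type*} [NormedAddCommGroup E] [InnerProductSpace ℝ E]
    [FiniteDimensional ℝ E] [MeasurableSpace E] [BorelSpace E] (ν : Measure E)
    [ν.IsAddHaarMeasure] {V W : Submodule ℝ E} (h : ¬W ≤ V) : ∀ᵐ x ∂ν, W.starProjection x ∉ V := by
  refine measure_eq_zero_iff_ae_notMem.1 (Measure.addHaar_submodule ν
    (V.comap (W.starProjection : E →ₗ[ℝ] E)) fun htop => h fun x hx => ?_)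
  rw [← Submodule.starProjection_eq_self_iff.2 hx]
  exact Submodule.eq_top_iff'.1 htop x

variable {d k : ℕ} {S : Finset (Fin d × Fin d)} {M : Matrix (Fin d) (Fin d) ℝ} {θ : Param d}
  {R : Set (Fin d ⊕ Fin d)} {U : Submodule ℝ (Fin d → ℝ)} {σ lam : ℝ} {u : Fin d ⊕ Fin d → ℝ}
  {w : Fin d → ℝ} {z : ℝ → Param d}

theorem isSemiflow_gradFlow_risk (S : Finset (Fin d × Fin d)) (M : Matrix (Fin d) (Fin d) ℝ) :
    IsSemiflow (fun θ => -gradient (risk S M) θ) (gradFlow (risk S M)) :=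
  isSemiflow_gradFlow contDiff_risk risk_nonneg

theorem ae_exists_isEscapeOrbit (hcrit : gradient (risk S M) θ = 0) (hσ : 0 < σ)
    (hu : IsSimpleTopEigenpair (dilation (residualMatrix S M θ)) σ u)
    (hU : U < ⊤) (hθ : ∀ r, augMatrix θ r ∈ U)
    (hlam : IsTopEigenvalue (-hessian (risk S M) θ) lam) :
    ∀ᵐ θ₀ : Param d, ∃ w ∉ U, ∃ z,
      IsEscapeOrbit (gradFlow (risk S M)) θ lam (rankOneParam u w) z ∧
      ∀ t, Tendsto (fun a => gradFlow (risk S M) (θ + a • θ₀) (t + 1 / lam * Real.log (1 / a)))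
        (𝓝[>] 0) (𝓝 (z t)) := by
  obtain ⟨w₀, hw₀U, hw₀⟩ := exists_notMem_mulVec_eq_zero hU hθ
  have hw₀0 : w₀ ≠ 0 := fun h => hw₀U (h ▸ U.zero_mem)
  have hlam_eq := topEigenvalue_neg_hessian_risk hu hw₀ hw₀0 hlam
  have hlam_pos := topEigenvalue_neg_hessian_risk_pos hσ hu hw₀ hw₀0 hlam
  obtain ⟨μ, hW⟩ := exists_isTopSpectralSplit (isSymmetric_neg_hessian_risk θ) hlam_pos hlam
  set W := Module.End.eigenspace
    ((-hessian (risk S M) θ : Param d →L[ℝ] Param d) : Param d →ₗ[ℝ] Param d) lam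
  have not_le : ¬W ≤ blockSubmodule Set.univ U := fun h =>
    hw₀U <| mem_of_rankOneParam_mem_blockSubmodule hu.ne_zero <| h <|
      Module.End.mem_eigenspace_iff.2 (hlam_eq ▸ neg_hessian_risk_rankOneParam hu.mulVec hw₀)
  rw [hessian, ← fderiv_fun_neg] at hW
  filter_upwards [ae_starProjection_notMem volume not_le] with θ₀ hθ₀
  obtain ⟨z, hz, hlim⟩ := exists_isEscapeOrbit (isSemiflow_gradFlow_risk S M)
    (contDiff_neg_gradient contDiff_risk) (by rw [hcrit, neg_zero]) hW θ₀
  have hS := nonempty_of_dilation_residualMatrix_mulVec hσ.ne' hu.ne_zero hu.mulVec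
  have eigenvector : (-hessian (risk S M) θ) (W.starProjection θ₀) =
      (2 / (S.card : ℝ) * σ) • W.starProjection θ₀ :=
    (Module.End.mem_eigenspace_iff.1 (W.starProjection_apply_mem θ₀)).trans
      (congrArg (· • W.starProjection θ₀) hlam_eq)
  obtain ⟨w, hw⟩ := exists_eq_rankOneParam hS hu eigenvector
  rw [hw] at hz hθ₀
  exact ⟨w, fun hwU => hθ₀ (rankOneParam_mem_blockSubmodule (fun _ hr => absurd trivial hr) hwU),
    z, hz, fun t => tendsto_of_tendsto_releasedCurve hlam_pos (hlim t)⟩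

namespace IsEscapeOrbit

theorem augMatrix_row_mem (hz : IsEscapeOrbit (gradFlow (risk S M)) θ lam (rankOneParam u w) z)
    (hθ : ∀ r, augMatrix θ r ∈ U) (hw : w ∈ U) (t : ℝ) (r : Fin d ⊕ Fin d) :
    augMatrix (z t) r ∈ U := by
  have invariant := hz.sub_mem (V := blockSubmodule Set.univ U) (e := 0)
    (isSemiflow_gradFlow_risk S M) (contDiff_neg_gradient contDiff_risk)
    (fun η hη => by
      rw [zero_add]
      exact neg_gradient_risk_mem_blockSubmodule (isBlock_univ S) hη)
    (by rwa [sub_zero, mem_blockSubmodule_univ])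
    (rankOneParam_mem_blockSubmodule (fun _ hr => absurd trivial hr) hw) t
  rw [sub_zero, mem_blockSubmodule_univ] at invariant
  exact invariant r

theorem rank_augMatrix_le_of_le {v : Param d} (hz : IsEscapeOrbit (gradFlow (risk S M)) θ lam v z)
    {s t : ℝ} (hst : s ≤ t) : (augMatrix (z s)).rank ≤ (augMatrix (z t)).rank := by
  have invariant := hz.sub_mem_iff (e := 0)
    (V := blockSubmodule Set.univ (Submodule.span ℝ (Set.range (augMatrix (z t)).row)))
    (isSemiflow_gradFlow_risk S M) (contDiff_neg_gradient contDiff_risk)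
    (fun η hη => by
      rw [zero_add]
      exact neg_gradient_risk_mem_blockSubmodule (isBlock_univ S) hη) hst
  rw [sub_zero, sub_zero, mem_blockSubmodule_univ, mem_blockSubmodule_univ] at invariant
  rw [(augMatrix (z t)).rank_eq_finrank_span_row]
  exact rank_le_finrank (invariant.1 fun r => Submodule.subset_span ⟨r, rfl⟩)

theorem eventually_rank_submatrix_add_one_le {m : Type*} [Fintype m]
    (hz : IsEscapeOrbit (gradFlow (risk S M)) θ lam (rankOneParam u w) z) (hlam : 0 < lam)
    (hθ : ∀ r, augMatrix θ r ∈ U) (hw : w ∉ U) {f : m → Fin d ⊕ Fin d} (hu0 : u ∘ f ≠ 0)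
    (hu : (u ∘ f) ᵥ* (augMatrix θ).submatrix f id = 0) :
    ∀ᶠ t in atBot, ((augMatrix θ).submatrix f id).rank + 1 ≤
      ((augMatrix (z t)).submatrix f id).rank := by
  have hcont : Continuous fun η : Param d => (augMatrix η).submatrix f id :=
    continuous_augMatrix.matrix_submatrix f id
  have leading := (hcont.tendsto _).comp hz.asymptotic
  simp only [Function.comp_def, augMatrix_smul, augMatrix_sub, augMatrix_rankOneParam] at leading
  exact eventually_rank_add_one_le ((hcont.tendsto θ).comp (hz.tendsto_atBot hlam)) leading hu hu0
    fun hmem => hw (Submodule.span_le.2 (Set.range_subset_iff.2 fun i => hθ (f i)) hmem)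

theorem augMatrix_row_sub_mem_span (hR : IsBlock S R)
    (hres : ∀ i j, Sum.inl i ∈ R → Sum.inr j ∈ R → residualMatrix S M θ i j = 0)
    (hθ : ∀ r ∉ R, augMatrix θ r = 0) (hσ : σ ≠ 0)
    (hu : dilation (residualMatrix S M θ) *ᵥ u = σ • u)
    (hz : IsEscapeOrbit (gradFlow (risk S M)) θ lam (rankOneParam u w) z) (t : ℝ)
    (r : Fin d ⊕ Fin d) : augMatrix (z t) r - augMatrix θ r ∈ Submodule.span ℝ {w} := by
  have invariant := hz.sub_mem (V := blockSubmodule Rᶜ (Submodule.span ℝ {w})) (e := θ)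
    (isSemiflow_gradFlow_risk S M) (contDiff_neg_gradient contDiff_risk)
    (fun _ => neg_gradient_risk_add_mem_blockSubmodule_compl hR hres hθ)
    (by
      rw [sub_self]
      exact Submodule.zero_mem _)
    (rankOneParam_mem_blockSubmodule
      (fun r hr => eq_zero_of_dilation_residualMatrix_mulVec hR hres hσ hu (not_not.1 hr))
      (Submodule.mem_span_singleton_self w)) t
  have hrow := invariant.1 r
  rwa [augMatrix_sub] at hrow

theorem augMatrix_row_mem_sup
    (hz : IsEscapeOrbit (gradFlow (risk S M)) θ lam (rankOneParam u w) z)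
    (hθ : ∀ r, augMatrix θ r ∈ U) (t : ℝ) (r : Fin d ⊕ Fin d) :
    augMatrix (z t) r ∈ U ⊔ Submodule.span ℝ {w} :=
  hz.augMatrix_row_mem (fun r => Submodule.mem_sup_left (hθ r))
    (Submodule.mem_sup_right (Submodule.mem_span_singleton_self w)) t r

theorem rank_augMatrix (hz : IsEscapeOrbit (gradFlow (risk S M)) θ lam (rankOneParam u w) z)
    (hlam : 0 < lam) (hθ : ∀ r, augMatrix θ r ∈ U) (hw : w ∉ U) (hu0 : u ≠ 0)
    (hu : u ᵥ* augMatrix θ = 0) (t : ℝ) :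
    (augMatrix (z t)).rank = (augMatrix θ).rank + 1 := by
  apply le_antisymm
  · have row_mem (r) : augMatrix θ r ∈ Submodule.span ℝ (Set.range (augMatrix θ).row) :=
      Submodule.subset_span ⟨r, rfl⟩
    rw [(augMatrix θ).rank_eq_finrank_span_row]
    exact rank_le_finrank_add_one (hz.augMatrix_row_mem_sup row_mem t)
  · obtain ⟨s, hs, hst⟩ := ((hz.eventually_rank_submatrix_add_one_le hlam hθ hw (f := id) hu0
      hu).and (eventually_le_atBot t)).exists
    exact hs.trans (hz.rank_augMatrix_le_of_le hst)

/- If the residual does not vanish on the block `R`, both factors of `θ` already have the maximal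
rank `k`. Otherwise `z` leaves `θ` along multiples of `w` only. -/
theorem rank_factors_le {α : Fin k → Fin d → ℝ} (hα : LinearIndependent ℝ α) (hR : IsBlock S R)
    (hθ : θ ∈ blockSubmodule R (Submodule.span ℝ (Set.range α)))
    (hsos : ∀ v ∈ blockSubmodule R (Submodule.span ℝ (Set.range α)),
      0 ≤ inner ℝ v (hessian (risk S M) θ v))
    (hσ : σ ≠ 0) (hu : dilation (residualMatrix S M θ) *ᵥ u = σ • u)
    (hz : IsEscapeOrbit (gradFlow (risk S M)) θ lam (rankOneParam u w) z) (t : ℝ) :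
    (factorA (z t)).rank ≤ (factorA θ).rank + 1 ∧
      (factorB (z t))ᵀ.rank ≤ (factorB θ)ᵀ.rank + 1 := by
  by_cases hres : ∀ i j, Sum.inl i ∈ R → Sum.inr j ∈ R → residualMatrix S M θ i j = 0
  · have row_mem (r) : augMatrix (z t) r ∈
        Submodule.span ℝ {augMatrix θ r} ⊔ Submodule.span ℝ {w} := by
      rw [← add_sub_cancel (augMatrix θ r) (augMatrix (z t) r)]
      exact Submodule.add_mem_sup (Submodule.mem_span_singleton_self _)
        (hz.augMatrix_row_sub_mem_span hR hres hθ.2 hσ hu t r)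
    rw [(factorA θ).rank_eq_finrank_span_row, (factorB θ)ᵀ.rank_eq_finrank_span_row]
    have span_row_le {X : Matrix (Fin d) (Fin d) ℝ} (i) :
        Submodule.span ℝ {X i} ≤ Submodule.span ℝ (Set.range X.row) :=
      Submodule.span_mono (Set.singleton_subset_iff.2 ⟨i, rfl⟩)
    exact ⟨
      rank_le_finrank_add_one fun i => sup_le_sup_right (span_row_le i) _ (row_mem (Sum.inl i)),
      rank_le_finrank_add_one fun j => sup_le_sup_right (span_row_le j) _ (row_mem (Sum.inr j))⟩
  · push Not at hres
    obtain ⟨i, j, hi, hj, hij⟩ := hres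
    have row_mem := hz.augMatrix_row_mem_sup hθ.1 t
    have hk : Module.finrank ℝ (Submodule.span ℝ (Set.range α)) = k :=
      (finrank_span_eq_card hα).trans (Fintype.card_fin k)
    have hA := rank_le_finrank_add_one (X := factorA (z t)) fun i => row_mem (Sum.inl i)
    have hB := rank_le_finrank_add_one (X := (factorB (z t))ᵀ) fun j => row_mem (Sum.inr j)
    rw [hk] at hA hB
    exact ⟨hA.trans (Nat.succ_le_succ (le_rank_factorA hα hsos hi hj hij)),
      hB.trans (Nat.succ_le_succ (le_rank_transpose_factorB hα hsos hi hj hij))⟩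

theorem mem_Omega_cons {α : Fin k → Fin d → ℝ}
    (hz : IsEscapeOrbit (gradFlow (risk S M)) θ lam (rankOneParam u w) z)
    (hθ : ∀ r, augMatrix θ r ∈ Submodule.span ℝ (Set.range α)) (t : ℝ) :
    z t ∈ Omega (Fin.cons w α : Fin (k + 1) → Fin d → ℝ) := by
  rw [← coe_blockSubmodule_univ_span, SetLike.mem_coe, mem_blockSubmodule_univ, Fin.range_cons,
    Submodule.span_insert, sup_comm]
  exact hz.augMatrix_row_mem_sup hθ t

theorem eventually_rank_factors {α : Fin k → Fin d → ℝ} (hα : LinearIndependent ℝ α)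
    (hR : IsBlock S R) (hθ : θ ∈ blockSubmodule R (Submodule.span ℝ (Set.range α)))
    (hsos : ∀ v ∈ blockSubmodule R (Submodule.span ℝ (Set.range α)),
      0 ≤ inner ℝ v (hessian (risk S M) θ v))
    (hσ : σ ≠ 0) (hu0 : u ≠ 0) (hu : dilation (residualMatrix S M θ) *ᵥ u = σ • u)
    (haug : dilation (residualMatrix S M θ) * augMatrix θ = 0)
    (hw : w ∉ Submodule.span ℝ (Set.range α)) (hlam : 0 < lam)
    (hz : IsEscapeOrbit (gradFlow (risk S M)) θ lam (rankOneParam u w) z) :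
    ∀ᶠ t in atBot, (factorA (z t)).rank = (factorA θ).rank + 1 ∧
      (factorB (z t)).rank = (factorB θ).rank + 1 := by
  filter_upwards [
    hz.eventually_rank_submatrix_add_one_le hlam hθ.1 hw
      (comp_inl_ne_zero_of_dilation_mulVec hσ hu0 hu) (comp_inl_vecMul_toRows₁_eq_zero hσ hu haug),
    hz.eventually_rank_submatrix_add_one_le hlam hθ.1 hw
      (comp_inr_ne_zero_of_dilation_mulVec hσ hu0 hu) (comp_inr_vecMul_toRows₂_eq_zero hσ hu haug)]
    with t hA hB
  obtain ⟨hA', hB'⟩ := hz.rank_factors_le hα hR hθ hsos hσ hu t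
  rw [← (factorB (z t)).rank_transpose, ← (factorB θ).rank_transpose]
  exact ⟨hA'.antisymm hA, hB'.antisymm hB⟩

end IsEscapeOrbit

end SaddleEscape

theorem mainTheorem1_general {d k : ℕ} (hk : k < d) {S : Finset (Fin d × Fin d)}
    {M : Matrix (Fin d) (Fin d) ℝ} {R : Set (Fin d ⊕ Fin d)} (hR : IsBlock S R)
    {α : Fin k → Fin d → ℝ} (hα : LinearIndependent ℝ α) {θc : Param d}
    (hθc : θc ∈ blockSubmodule R (Submodule.span ℝ (Set.range α)))
    (htop : UniqueTopSingularValue (residualMatrix S M θc))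
    (hsos : IsSecondOrderStationaryWithin (risk S M)
      (blockSubmodule R (Submodule.span ℝ (Set.range α))) θc)
    {lam : ℝ} (hlam : IsTopEigenvalue (-hessian (risk S M) θc) lam) :
    (∀ θ₀ : Param d, IsGradientFlowFrom (risk S M) θ₀ (gradFlow (risk S M) θ₀)) ∧
    ∀ᵐ θ₀ : Param d ∂(volume : Measure (Param d)), ∃ z : ℝ → Param d,
      (∀ t : ℝ, Tendsto
        (fun a : ℝ => gradFlow (risk S M) (θc + a • θ₀) (t + 1 / lam * Real.log (1 / a)))
        (𝓝[>] 0) (𝓝 (z t))) ∧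
      (∃ β : Fin (k + 1) → Fin d → ℝ, LinearIndependent ℝ β ∧ ∀ t : ℝ, z t ∈ Omega β) ∧
      (∀ t : ℝ, (augMatrix (z t)).rank = (augMatrix θc).rank + 1) ∧
      (∀ᶠ t : ℝ in atBot, (factorA (z t)).rank = (factorA θc).rank + 1 ∧
        (factorB (z t)).rank = (factorB θc).rank + 1) := by
  obtain ⟨hcrit, hsos⟩ := hsos
  obtain ⟨σ, hσ, u, hu⟩ := exists_isSimpleTopEigenpair_dilation htop
  have hU : Submodule.span ℝ (Set.range α) < ⊤ := by
    refine Submodule.lt_top_of_finrank_lt_finrank ?_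
    rwa [finrank_span_eq_card hα, Module.finrank_fin_fun, Fintype.card_fin]
  obtain ⟨w₀, hw₀U, hw₀⟩ := exists_notMem_mulVec_eq_zero hU hθc.1
  have hw₀0 : w₀ ≠ 0 := fun h => hw₀U (h ▸ Submodule.zero_mem _)
  have hlam_pos := topEigenvalue_neg_hessian_risk_pos hσ hu hw₀ hw₀0 hlam
  have hS := nonempty_of_dilation_residualMatrix_mulVec hσ.ne' hu.ne_zero hu.mulVec
  have haug := dilation_residualMatrix_mul_augMatrix hS hcrit
  have hu_aug := vecMul_eq_zero_of_dilation_mulVec hσ.ne' hu.mulVec haug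
  refine ⟨isGradientFlowFrom_gradFlow contDiff_risk risk_nonneg, ?_⟩
  filter_upwards [ae_exists_isEscapeOrbit hcrit hσ hu hU hθc.1 hlam]
    with θ₀ ⟨w, hw, z, hz, hlim⟩
  exact ⟨z, hlim, ⟨Fin.cons w α, linearIndependent_finCons.2 ⟨hα, hw⟩, hz.mem_Omega_cons hθc.1⟩,
    hz.rank_augMatrix hlam_pos hθc.1 hw hu.ne_zero hu_aug,
    hz.eventually_rank_factors hα hR hθc hsos hσ.ne' hu.ne_zero hu.mulVec haug hw hlam_pos⟩

theorem mainTheorem1 {d k : ℕ} (hk : k < d)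
    (S : Finset (Fin d × Fin d)) (M : Matrix (Fin d) (Fin d) ℝ)
    (Ω : Set (Param d)) (hΩ : IsRankInvariantManifold S k Ω)
    (θc : Param d) (hθc : θc ∈ Ω)
    (htop : UniqueTopSingularValue (residualMatrix S M θc))
    (hsos : IsSecondOrderStationaryWithin (risk S M) Ω θc)
    (lam : ℝ) (hlam : IsTopEigenvalue (-hessian (risk S M) θc) lam) :
    (∀ θ₀ : Param d, IsGradientFlowFrom (risk S M) θ₀ (gradFlow (risk S M) θ₀)) ∧
    ∀ᵐ θ₀ : Param d ∂(volume : Measure (Param d)), ∃ z : ℝ → Param d,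
      (∀ t : ℝ, Tendsto
        (fun a : ℝ => gradFlow (risk S M) (θc + a • θ₀) (t + 1 / lam * Real.log (1 / a)))
        (𝓝[>] 0) (𝓝 (z t))) ∧
      (∃ β : Fin (k + 1) → Fin d → ℝ, LinearIndependent ℝ β ∧ ∀ t : ℝ, z t ∈ Omega β) ∧
      (∀ t : ℝ, (augMatrix (z t)).rank = (augMatrix θc).rank + 1) ∧
      (∀ᶠ t : ℝ in atBot, (factorA (z t)).rank = (factorA θc).rank + 1 ∧
        (factorB (z t)).rank = (factorB θc).rank + 1) := by
  obtain ⟨α, R, hα, hR, rfl⟩ := hΩ.exists_eq_blockSubmodule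
  exact mainTheorem1_general hk hR hα hθc htop hsos hlam

end
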